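/- A Delzant polytope in $\mathbb{R}^n$ is a full-dimensional convex polytope $P\subset\mathbb{R}^n$ whose normal fan is unimodular: for every face $F$ of $P$, the normal cone $N(P,F)=\{\alpha\in(\mathbb{R}^n)^* : \langle\alpha,p-q\rangle\ge 0 \text{ for all } p\in F,\ q\in P\}$ is generated by linearly independent primitive integer vectors $v_1,\dots,v_m$ which generate (as a group) the lattice of integer vectors in their linear span. Let $\mathcal{D}(2)$ be the set of all Delzant polygons, i.e. Delzant polytopes in $\mathbb{R}^2$, with the topology induced by either of the two metrics $$\delta^H(P,Q)=\max\Big\{\max_{x\in P}\min_{y\in Q}\|x-y\|,\ \max_{y\in Q}\min_{x\in P}\|x-y\|\Big\},\qquad \delta^V(P,Q)=\operatorname{Vol}(P\setminus Q)+\operatorname{Vol}(Q\setminus P).$$ Then $\mathcal{D}(2)$ is simply connected: for each of these two topologies, it is nonempty and path connected and every loop in it is null-homotopic. -/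

import Mathlib

open MeasureTheory

namespace DelzantModuli

/-- The lattice `ℤⁿ` of vectors with integer coordinates in Euclidean space `ℝⁿ`. -/
def integerLattice (n : ℕ) : AddSubgroup (EuclideanSpace ℝ (Fin n)) where
  carrier := {x | ∀ i, ∃ k : ℤ, x i = (k : ℝ)}
  zero_mem' := fun _ => ⟨0, by simp⟩
  add_mem' := by
    intro x y hx hy i
    obtain ⟨a, ha⟩ := hx i
    obtain ⟨b, hb⟩ := hy i
    exact ⟨a + b, by simp [ha, hb]⟩
  neg_mem' := by
    intro x hx i
    obtain ⟨a, ha⟩ := hx i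
    exact ⟨-a, by simp [ha]⟩

/-- A primitive vector: an integer vector whose coordinates have greatest common divisor `1`
(in particular it is nonzero). -/
def IsPrimitive {n : ℕ} (v : EuclideanSpace ℝ (Fin n)) : Prop :=
  ∃ z : Fin n → ℤ, (∀ i, v i = (z i : ℝ)) ∧ Finset.univ.gcd z = 1

/-- The cone generated by finitely many vectors. -/
def coneOf {n m : ℕ} (v : Fin m → EuclideanSpace ℝ (Fin n)) : Set (EuclideanSpace ℝ (Fin n)) :=
  {x | ∃ a : Fin m → ℝ, (∀ i, 0 ≤ a i) ∧ x = ∑ i, a i • v i}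

/-- The multiplicity of the simplicial cone `C` with primitive ray generators `v`: the index of the
sublattice generated by the `v i` in the lattice `ℝC ∩ ℤⁿ`. -/
noncomputable def coneMultiplicity {n m : ℕ} (v : Fin m → EuclideanSpace ℝ (Fin n)) : ℕ :=
  (AddSubgroup.closure (Set.range v)).relIndex
    ((Submodule.span ℝ (coneOf v)).toAddSubgroup ⊓ integerLattice n)

/-- A unimodular cone: a rational simplicial cone of multiplicity one. The zero cone is the case
`m = 0`. -/
def IsUnimodularCone {n : ℕ} (C : Set (EuclideanSpace ℝ (Fin n))) : Prop :=
  ∃ (m : ℕ) (v : Fin m → EuclideanSpace ℝ (Fin n)),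
    (∀ i, IsPrimitive (v i)) ∧ LinearIndependent ℝ v ∧ C = coneOf v ∧ coneMultiplicity v = 1

/-- The face of `P` in the direction `α`. The dual space of `ℝⁿ` is identified with `ℝⁿ` by the
standard inner product. -/
def face {n : ℕ} (P : Set (EuclideanSpace ℝ (Fin n))) (α : EuclideanSpace ℝ (Fin n)) :
    Set (EuclideanSpace ℝ (Fin n)) :=
  {p | p ∈ P ∧ ∀ x ∈ P, inner ℝ α x ≤ inner ℝ α p}

/-- The normal cone of a face `F` of `P`. -/
def normalCone {n : ℕ} (P F : Set (EuclideanSpace ℝ (Fin n))) :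
    Set (EuclideanSpace ℝ (Fin n)) :=
  {α | F ⊆ face P α}

/-- The normal fan of `P`: the collection of the normal cones of all faces of `P`. -/
def normalFan {n : ℕ} (P : Set (EuclideanSpace ℝ (Fin n))) :
    Set (Set (EuclideanSpace ℝ (Fin n))) :=
  {C | ∃ α, C = normalCone P (face P α)}

/-- A Delzant polytope in `ℝⁿ`: a (nonempty) full-dimensional convex polytope whose normal fan is
unimodular, that is, all of whose normal cones are rational, simplicial and of multiplicity one.
(The normal fan of a polytope is always a complete fan, so nothing else has to be required.) -/
def IsDelzant {n : ℕ} (P : ConvexBody (EuclideanSpace ℝ (Fin n))) : Prop :=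
  (∃ S : Finset (EuclideanSpace ℝ (Fin n)),
    (P : Set (EuclideanSpace ℝ (Fin n))) = convexHull ℝ (S : Set (EuclideanSpace ℝ (Fin n)))) ∧
  affineSpan ℝ (P : Set (EuclideanSpace ℝ (Fin n))) = ⊤ ∧
  ∀ C ∈ normalFan (P : Set (EuclideanSpace ℝ (Fin n))), IsUnimodularCone C

/-- The set `𝒟(n)` of all Delzant polytopes in `ℝⁿ`. -/
def DelzantPolytope (n : ℕ) : Type :=
  {P : ConvexBody (EuclideanSpace ℝ (Fin n)) // IsDelzant P}

/-- The underlying set of points of a Delzant polytope. -/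
def DelzantPolytope.toSet {n : ℕ} (P : DelzantPolytope n) : Set (EuclideanSpace ℝ (Fin n)) :=
  (P.1 : Set (EuclideanSpace ℝ (Fin n)))

/-- The Hausdorff distance on `𝒟(n)`. -/
noncomputable abbrev hausdorffMetric (n : ℕ) : PseudoMetricSpace (DelzantPolytope n) where
  dist P Q := Metric.hausdorffDist P.toSet Q.toSet
  dist_self _ := Metric.hausdorffDist_self_zero
  dist_comm _ _ := Metric.hausdorffDist_comm
  dist_triangle _ _ _ := Metric.hausdorffDist_triangle ConvexBody.hausdorffEDist_ne_top

/-- The symmetric difference distance `Vol (P \ Q) + Vol (Q \ P)` on `𝒟(n)`. -/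
noncomputable abbrev symmDiffMetric (n : ℕ) : PseudoMetricSpace (DelzantPolytope n) where
  dist P Q := volume.real (P.toSet \ Q.toSet) + volume.real (Q.toSet \ P.toSet)
  dist_self P := by simp
  dist_comm P Q := add_comm _ _
  dist_triangle P Q R := by
    have key : ∀ A B C : DelzantPolytope n, volume.real (A.toSet \ C.toSet) ≤
        volume.real (A.toSet \ B.toSet) + volume.real (B.toSet \ C.toSet) := by
      intro A B C
      have hfin : ∀ A B : DelzantPolytope n, volume (A.toSet \ B.toSet) ≠ ⊤ := fun A B =>
        ((measure_mono Set.sdiff_subset).trans_lt A.1.isCompact.measure_lt_top).ne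
      refine (measureReal_mono (s₂ := A.toSet \ B.toSet ∪ B.toSet \ C.toSet) ?_
        (measure_union_ne_top (hfin A B) (hfin B C))).trans (measureReal_union_le _ _)
      rintro x ⟨hA, hC⟩
      by_cases hB : x ∈ B.toSet
      · exact Or.inr ⟨hB, hC⟩
      · exact Or.inl ⟨hA, hB⟩
    linarith [key P Q R, key R Q P]

/-- The topology of `𝒟(n)` induced by the Hausdorff distance. -/
noncomputable abbrev hausdorffTopology (n : ℕ) : TopologicalSpace (DelzantPolytope n) :=
  (hausdorffMetric n).toUniformSpace.toTopologicalSpace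

/-- The topology of `𝒟(n)` induced by the symmetric difference distance. -/
noncomputable abbrev symmDiffTopology (n : ℕ) : TopologicalSpace (DelzantPolytope n) :=
  (symmDiffMetric n).toUniformSpace.toTopologicalSpace

/-- The set `X` with the topology `t` is simply connected: nonempty, path connected and with trivial
fundamental group. (Mathlib's notion, with the topology as an explicit argument.) -/
def SimplyConnectedWith {X : Type} (t : TopologicalSpace X) : Prop :=
  @SimplyConnectedSpace X t

end DelzantModuli

/-!
If the normal fan of `P` refines that of `Q`, then for `t < 1` the Minkowski combination
`(1 - t) P + t Q` has the normal fan of `P`, so the whole path from `P` to `Q` consists of Delzant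
polytopes. Two facts make this enough to contract loops of polygons.

* The normal fan of every Delzant polygon `P` near `Q` refines that of `Q`. Indeed, an integer
  vector `r` is a positive integral combination of the generators of the smallest cone of the fan of
  `P` containing it, and these generators are bounded because `P` contains a fixed ball; this leaves
  finitely many conditions on support functions, each of which is closed.
* The zonotope generated by all integer vectors in the box of size `N` is Delzant, as neighbouring
  Farey directions form a basis of the lattice, and for large `N` its fan refines that of any given
  Delzant polygon.

Cut a path into pieces, each of which stays near one polygon. All these polygons are refined by a
single zonotope, so every piece, and hence the path, is homotopic to the path which passes through
the zonotope.

The two metrics induce the same topology. The symmetric difference of `P` and `Q` lies in a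
neighbourhood of the frontier of `P`, a null set, of radius their Hausdorff distance. Conversely, if
the centre of a ball in `P` is not in `Q`, then at least half of the ball is outside `Q`.
-/

namespace DelzantModuli

section PathSystem

open unitInterval Filter Topology

variable {X : Type*} [TopologicalSpace X]

theorem homotopic_of_square {a b c d : X} (p : Path a b) (q : Path c d) (l : Path a c)
    (r : Path b d) (F : I × I → X) (hF : Continuous F) (hp : ∀ s, F (0, s) = p s)
    (hq : ∀ s, F (1, s) = q s) (hl : ∀ t, F (t, 0) = l t) (hr : ∀ t, F (t, 1) = r t) :
    (p.trans r).Homotopic (l.trans q) := by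
  obtain rfl : F (0, 0) = a := by simp [hp]
  obtain rfl : F (0, 1) = b := by simp [hp]
  obtain rfl : F (1, 0) = c := by simp [hq]
  obtain rfl : F (1, 1) = d := by simp [hq]
  let bottom : C(I, X) := ⟨fun s => F (0, s), by fun_prop⟩
  let top : C(I, X) := ⟨fun s => F (1, s), by fun_prop⟩
  let H : bottom.Homotopy top := ⟨⟨F, hF⟩, fun _ => rfl, fun _ => rfl⟩
  let diagonal : Path (0 : I) 1 := ⟨⟨id, continuous_id⟩, rfl, rfl⟩
  have h_bottom : diagonal.map bottom.continuous = p := Path.ext (funext hp)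
  have h_top : diagonal.map top.continuous = q := Path.ext (funext hq)
  have h_left : H.evalAt 0 = l := Path.ext (funext hl)
  have h_right : H.evalAt 1 = r := Path.ext (funext hr)
  rw [← h_bottom, ← h_top, ← h_left, ← h_right]
  exact Path.Homotopic.map_trans_evalAt H diagonal

variable (X) in
/-- A relation on `X` together with paths joining related points, which depend continuously on
their end points and stay related to every point that is related to both ends. -/
structure PathSystem where
  ofPaths ::
  Rel : X → X → Prop
  path {x y : X} : Rel x y → Path x y
  continuous_path {f g : I → X} (h : ∀ s, Rel (f s) (g s)) : Continuous f → Continuous g →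
    Continuous fun p : I × I => path (h p.2) p.1
  rel_path {z x y : X} (h : Rel x y) : Rel z x → Rel z y → ∀ t, Rel z (path h t)

namespace PathSystem

open Path.Homotopic.Quotient
  (mk mk_trans mk_refl trans_assoc trans_refl refl_trans trans_symm symm_trans)

variable (S : PathSystem X) {x y w z q : X}

/-- Following the system path from `z` to the start of `γ` and then `γ` is homotopic to the system
path from `z` to the end of `γ`, whenever `z` is related to both ends. -/
def IsConedFrom (z : X) (γ : Path x y) : Prop :=
  ∀ (hx : S.Rel z x) (hy : S.Rel z y), (mk (S.path hx)).trans (mk γ) = mk (S.path hy)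

variable {S}

theorem mk_trans_mk_path {γ : Path x y} (h : ∀ s, S.Rel (γ s) q) (hx : S.Rel x q)
    (hy : S.Rel y q) : (mk γ).trans (mk (S.path hy)) = mk (S.path hx) := by
  have square := Path.Homotopic.Quotient.eq.mpr <|
    homotopic_of_square γ (Path.refl q) (S.path hx) (S.path hy) (fun p => S.path (h p.2) p.1)
      (S.continuous_path h γ.continuous continuous_const)
      (by simp) (by simp) (fun t => by congr! <;> simp) (fun t => by congr! <;> simp)
  rwa [mk_trans, mk_trans, mk_refl, trans_refl] at square

theorem isConedFrom_path (h : S.Rel x y) : S.IsConedFrom z (S.path h) := by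
  intro hx hy
  have hz : ∀ s, S.Rel z (S.path h s) := S.rel_path h hx hy
  have square := Path.Homotopic.Quotient.eq.mpr <|
    homotopic_of_square (Path.refl z) (S.path h) (S.path hx) (S.path hy)
      (fun p => S.path (hz p.2) p.1) (S.continuous_path hz continuous_const (S.path h).continuous)
      (by simp) (by simp) (fun t => by congr! <;> simp) (fun t => by congr! <;> simp)
  rw [mk_trans, mk_trans, mk_refl, refl_trans] at square
  exact square.symm

theorem isConedFrom_refl (z x : X) : S.IsConedFrom z (Path.refl x) := fun _ _ => by
  rw [mk_refl, trans_refl]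

theorem isConedFrom_cast {x' y' : X} {γ : Path x y} (hx : x' = x) (hy : y' = y) :
    S.IsConedFrom z (γ.cast hx hy) ↔ S.IsConedFrom z γ := by
  subst hx hy
  rfl

theorem IsConedFrom.trans {γ : Path x y} {γ' : Path y w} (hγ : S.IsConedFrom z γ)
    (hγ' : S.IsConedFrom z γ') (hy : S.Rel z y) : S.IsConedFrom z (γ.trans γ') := fun hx hw => by
  rw [mk_trans, ← trans_assoc, hγ hx hy, hγ' hy hw]

theorem IsConedFrom.of_homotopic {γ γ' : Path x y} (hγ : S.IsConedFrom z γ)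
    (h : γ.Homotopic γ') : S.IsConedFrom z γ' := fun hx hy => by
  rw [← Path.Homotopic.Quotient.eq.mpr h, hγ hx hy]

theorem IsConedFrom.homotopic {γ γ' : Path x y} (hγ : S.IsConedFrom z γ)
    (hγ' : S.IsConedFrom z γ') (hx : S.Rel z x) (hy : S.Rel z y) : γ.Homotopic γ' := by
  have h := congrArg (mk (S.path hx)).symm.trans ((hγ hx hy).trans (hγ' hx hy).symm)
  simpa only [← trans_assoc, symm_trans, refl_trans, Path.Homotopic.Quotient.eq] using h

theorem isConedFrom_of_forall_rel {γ : Path x y} (h : ∀ s, S.Rel (γ s) q) (hq : S.Rel z q) :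
    S.IsConedFrom z γ := by
  intro hx hy
  have hxq : S.Rel x q := by simpa using h 0
  have hyq : S.Rel y q := by simpa using h 1
  have to_q : ((mk (S.path hx)).trans (mk γ)).trans (mk (S.path hyq)) =
      (mk (S.path hy)).trans (mk (S.path hyq)) := by
    rw [trans_assoc, mk_trans_mk_path h hxq hyq, isConedFrom_path hxq hx hq,
      isConedFrom_path hyq hy hq]
  simpa only [trans_assoc, trans_symm, trans_refl] using
    congrArg (·.trans (mk (S.path hyq)).symm) to_q

theorem isConedFrom_subpath {γ : Path x y} {t₀ t₁ : I} (h_le : t₀ ≤ t₁)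
    (h : ∀ s ∈ Set.Icc t₀ t₁, S.Rel (γ s) q) (hq : S.Rel z q) :
    S.IsConedFrom z (γ.subpath t₀ t₁) := by
  refine isConedFrom_of_forall_rel (fun s => ?_) hq
  have hs : γ.subpath t₀ t₁ s ∈ γ '' Set.Icc t₀ t₁ :=
    γ.range_subpath_of_le t₀ t₁ h_le ▸ Set.mem_range_self s
  obtain ⟨u, hu, hus⟩ := hs
  exact hus ▸ h u hu

variable {ι : Type*} {l : Filter ι} {Z : ι → X}

theorem eventually_isConedFrom (h_nhds : ∀ y, ∀ᶠ x in 𝓝 y, S.Rel x y)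
    (hZ : ∀ x, ∀ᶠ i in l, S.Rel (Z i) x) (γ : Path x y) :
    ∀ᶠ i in l, S.IsConedFrom (Z i) γ := by
  obtain ⟨t, ht_zero, ht_mono, ⟨n, hn⟩, ht⟩ := exists_monotone_Icc_subset_open_cover_unitInterval
    (c := fun s : I => interior {u | S.Rel (γ u) (γ s)}) (fun _ => isOpen_interior)
    (fun s _ => Set.mem_iUnion.mpr ⟨s, mem_interior_iff_mem_nhds.mpr
      (γ.continuous.continuousAt.eventually (h_nhds (γ s)))⟩)
  have h_initial (m : ℕ) : ∀ᶠ i in l, S.IsConedFrom (Z i) (γ.subpath (t 0) (t m)) := by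
    induction m with
    | zero => exact .of_forall fun i => γ.subpath_self (t 0) ▸ isConedFrom_refl _ _
    | succ m ih =>
      obtain ⟨s, hs⟩ := ht m
      filter_upwards [ih, hZ (γ (t m)), hZ (γ s)] with i h_cone h_mid h_center
      have h_rel : Set.Icc (t m) (t (m + 1)) ⊆ {u | S.Rel (γ u) (γ s)} :=
        hs.trans interior_subset
      have h_last : S.IsConedFrom (Z i) (γ.subpath (t m) (t (m + 1))) :=
        isConedFrom_subpath (ht_mono m.le_succ) h_rel h_center
      exact (h_cone.trans h_last h_mid).of_homotopic ⟨Path.Homotopy.subpathTransSubpath γ _ _ _⟩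
  have h_whole := h_initial n
  rw [ht_zero, hn n le_rfl, Path.subpath_zero_one] at h_whole
  simpa only [isConedFrom_cast] using h_whole

theorem simplyConnectedSpace [Nonempty X] [l.NeBot] (h_nhds : ∀ y, ∀ᶠ x in 𝓝 y, S.Rel x y)
    (hZ : ∀ x, ∀ᶠ i in l, S.Rel (Z i) x) : SimplyConnectedSpace X := by
  refine simply_connected_iff_paths_homotopic'.mpr
    ⟨⟨inferInstance, fun x y => ?_⟩, fun {x y} p q => ?_⟩
  · obtain ⟨i, hx, hy⟩ := ((hZ x).and (hZ y)).exists
    exact ⟨(S.path hx).symm.trans (S.path hy)⟩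
  · obtain ⟨i, hx, hy, hp, hq⟩ := ((hZ x).and ((hZ y).and ((eventually_isConedFrom h_nhds hZ p).and
      (eventually_isConedFrom h_nhds hZ q)))).exists
    exact hp.homotopic hq hx hy

end PathSystem

end PathSystem

section ConvexBodies

open Filter Topology Pointwise

section Minkowski

variable {V : Type*} [SeminormedAddCommGroup V] [NormedSpace ℝ V]

theorem convexBody_dist_le {P Q : ConvexBody V} {r : ℝ} (hr : 0 ≤ r)
    (hP : ∀ x ∈ P, ∃ y ∈ Q, dist x y ≤ r) (hQ : ∀ y ∈ Q, ∃ x ∈ P, dist y x ≤ r) :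
    dist P Q ≤ r := by
  rw [← ConvexBody.hausdorffDist_coe]
  exact Metric.hausdorffDist_le_of_mem_dist hr hP hQ

theorem exists_mem_dist_le_dist (P Q : ConvexBody V) {x : V} (hx : x ∈ P) :
    ∃ y ∈ Q, dist x y ≤ dist P Q := by
  obtain ⟨y, hy, hxy⟩ := Q.isCompact.exists_infDist_eq_dist Q.nonempty x
  refine ⟨y, hy, ?_⟩
  rw [← hxy, ← ConvexBody.hausdorffDist_coe]
  exact Metric.infDist_le_hausdorffDist_of_mem hx ConvexBody.hausdorffEDist_ne_top

theorem convexBody_dist_add_add_le (P Q P' Q' : ConvexBody V) :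
    dist (P + Q) (P' + Q') ≤ dist P P' + dist Q Q' := by
  have h_near : ∀ P Q P' Q' : ConvexBody V, ∀ x ∈ P + Q,
      ∃ y ∈ P' + Q', dist x y ≤ dist P P' + dist Q Q' := by
    rintro P Q P' Q' _ ⟨x, hx, y, hy, rfl⟩
    obtain ⟨x', hx', hxx'⟩ := exists_mem_dist_le_dist P P' hx
    obtain ⟨y', hy', hyy'⟩ := exists_mem_dist_le_dist Q Q' hy
    exact ⟨x' + y', Set.add_mem_add hx' hy',
      (dist_add_add_le _ _ _ _).trans (add_le_add hxx' hyy')⟩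
  refine convexBody_dist_le (by positivity) (h_near P Q P' Q') fun y hy => ?_
  rw [dist_comm P, dist_comm Q]
  exact h_near P' Q' P Q y hy

theorem convexBody_dist_smul_smul_le {P Q : ConvexBody V} {R : ℝ} (hR : ∀ x ∈ Q, ‖x‖ ≤ R)
    (s t : ℝ) : dist (s • P) (t • Q) ≤ |s| * dist P Q + |s - t| * R := by
  have hR0 : 0 ≤ R := Q.nonempty.elim fun x hx => (norm_nonneg x).trans (hR x hx)
  have h_point : ∀ x, ∀ y ∈ Q, dist x y ≤ dist P Q →
      dist (s • x) (t • y) ≤ |s| * dist P Q + |s - t| * R := fun x y hy hxy =>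
    calc dist (s • x) (t • y) ≤ dist (s • x) (s • y) + dist (s • y) (t • y) := dist_triangle _ _ _
      _ = |s| * dist x y + |s - t| * ‖y‖ := by
        rw [dist_smul₀, dist_eq_norm (s • y), ← sub_smul, norm_smul]
        simp only [Real.norm_eq_abs]
      _ ≤ |s| * dist P Q + |s - t| * R := by gcongr; exact hR y hy
  refine convexBody_dist_le (by positivity) ?_ ?_
  · rintro _ ⟨x, hx, rfl⟩
    obtain ⟨y, hy, hxy⟩ := exists_mem_dist_le_dist P Q hx
    exact ⟨t • y, Set.smul_mem_smul_set hy, h_point x y hy hxy⟩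
  · rintro _ ⟨y, hy, rfl⟩
    obtain ⟨x, hx, hyx⟩ := exists_mem_dist_le_dist Q P hy
    rw [dist_comm, dist_comm Q] at hyx
    exact ⟨s • x, Set.smul_mem_smul_set hx, dist_comm (t • y) _ ▸ h_point x y hy hyx⟩

instance : ContinuousAdd (ConvexBody V) where
  continuous_add := (LipschitzWith.of_dist_le_mul (K := 2) fun p q => by
    have h_fst : dist p.1 q.1 ≤ dist p q := le_max_left _ _
    have h_snd : dist p.2 q.2 ≤ dist p q := le_max_right _ _
    have h_add := convexBody_dist_add_add_le p.1 p.2 q.1 q.2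
    push_cast
    linarith).continuous

instance : ContinuousSMul ℝ (ConvexBody V) where
  continuous_smul := by
    refine continuous_iff_continuousAt.mpr fun p => tendsto_iff_dist_tendsto_zero.mpr ?_
    obtain ⟨R, hR⟩ := p.2.isBounded.exists_norm_le
    have h_bound : Continuous fun q : ℝ × ConvexBody V =>
      |q.1| * dist q.2 p.2 + |q.1 - p.1| * R := by fun_prop
    exact squeeze_zero (fun _ => dist_nonneg) (fun q => convexBody_dist_smul_smul_le hR q.1 p.1)
      (by simpa using h_bound.tendsto p)

/-- The point at time `t` of the segment from `P` to `Q` under Minkowski addition. -/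
noncomputable def minkowskiComb (P Q : ConvexBody V) (t : ℝ) : ConvexBody V := (1 - t) • P + t • Q

theorem zero_smul_convexBody (P : ConvexBody V) : (0 : ℝ) • P = 0 :=
  ConvexBody.ext <| by
    rw [ConvexBody.coe_smul, ConvexBody.coe_zero, Set.zero_smul_set P.nonempty]

@[simp]
theorem minkowskiComb_zero (P Q : ConvexBody V) : minkowskiComb P Q 0 = P := by
  rw [minkowskiComb, sub_zero, one_smul, zero_smul_convexBody, add_zero]

@[simp]
theorem minkowskiComb_one (P Q : ConvexBody V) : minkowskiComb P Q 1 = Q := by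
  rw [minkowskiComb, sub_self, one_smul, zero_smul_convexBody, zero_add]

theorem minkowskiComb_induction {P Q : ConvexBody V} {p : ConvexBody V → Prop} (hP : p P) (hQ : p Q)
    (h : ∀ t ∈ Set.Ioo (0 : ℝ) 1, p (minkowskiComb P Q t)) {t : ℝ}
    (ht : t ∈ Set.Icc 0 1) : p (minkowskiComb P Q t) := by
  obtain rfl | rfl | ht := Set.eq_endpoints_or_mem_Ioo_of_mem_Icc ht
  · rwa [minkowskiComb_zero]
  · rwa [minkowskiComb_one]
  · exact h t ht

@[fun_prop]
theorem continuous_minkowskiComb {Y : Type*} [TopologicalSpace Y] {f g : Y → ConvexBody V}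
    {t : Y → ℝ} (hf : Continuous f) (hg : Continuous g) (ht : Continuous t) :
    Continuous fun y => minkowskiComb (f y) (g y) (t y) := by
  unfold minkowskiComb
  fun_prop

end Minkowski

section Support

open Metric
open scoped RealInnerProductSpace

variable {V : Type*} [NormedAddCommGroup V] [InnerProductSpace ℝ V] {P Q : ConvexBody V}

/-- The support function of a convex body. -/
noncomputable def supportFun (P : ConvexBody V) (u : V) : ℝ := sSup ((fun x => ⟪u, x⟫) '' P)

theorem isGreatest_supportFun (P : ConvexBody V) (u : V) :
    IsGreatest ((fun x => ⟪u, x⟫) '' P) (supportFun P u) :=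
  (P.isCompact.image (by fun_prop)).isGreatest_sSup (P.nonempty.image _)

theorem inner_le_supportFun {x : V} (hx : x ∈ P) (u : V) : ⟪u, x⟫ ≤ supportFun P u :=
  (isGreatest_supportFun P u).2 ⟨x, hx, rfl⟩

theorem exists_inner_eq_supportFun (P : ConvexBody V) (u : V) : ∃ x ∈ P, ⟪u, x⟫ = supportFun P u :=
  (isGreatest_supportFun P u).1

theorem inner_eq_supportFun_iff {x u : V} (hx : x ∈ P) :
    ⟪u, x⟫ = supportFun P u ↔ ∀ y ∈ P, ⟪u, y⟫ ≤ ⟪u, x⟫ :=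
  ⟨fun h _ hy => h ▸ inner_le_supportFun hy u, fun h => (inner_le_supportFun hx u).antisymm <| by
    obtain ⟨y, hy, huy⟩ := exists_inner_eq_supportFun P u
    exact huy ▸ h y hy⟩

theorem supportFun_add (P Q : ConvexBody V) (u : V) :
    supportFun (P + Q) u = supportFun P u + supportFun Q u := by
  obtain ⟨p, hp, hup⟩ := exists_inner_eq_supportFun P u
  obtain ⟨q, hq, huq⟩ := exists_inner_eq_supportFun Q u
  rw [← hup, ← huq, ← inner_add_right, eq_comm,
    inner_eq_supportFun_iff (P := P + Q) (Set.add_mem_add hp hq)]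
  rintro _ ⟨x, hx, y, hy, rfl⟩
  simp only [inner_add_right, hup, huq]
  exact add_le_add (inner_le_supportFun hx u) (inner_le_supportFun hy u)

theorem supportFun_smul (P : ConvexBody V) {c : ℝ} (hc : 0 ≤ c) (u : V) :
    supportFun (c • P) u = c * supportFun P u := by
  obtain ⟨p, hp, hup⟩ := exists_inner_eq_supportFun P u
  rw [← hup, ← real_inner_smul_right, eq_comm,
    inner_eq_supportFun_iff (P := c • P) (Set.smul_mem_smul_set hp)]
  rintro _ ⟨x, hx, rfl⟩
  simp only [real_inner_smul_right, hup]
  exact mul_le_mul_of_nonneg_left (inner_le_supportFun hx u) hc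

theorem supportFun_le_add_norm_mul_dist (P Q : ConvexBody V) (u : V) :
    supportFun P u ≤ supportFun Q u + ‖u‖ * dist P Q := by
  obtain ⟨x, hx, hux⟩ := exists_inner_eq_supportFun P u
  obtain ⟨y, hy, hxy⟩ := exists_mem_dist_le_dist P Q hx
  calc supportFun P u = ⟪u, y⟫ + ⟪u, x - y⟫ := by rw [← hux, ← inner_add_right, add_sub_cancel]
    _ ≤ supportFun Q u + ‖u‖ * ‖x - y‖ :=
      add_le_add (inner_le_supportFun hy u) (real_inner_le_norm _ _)
    _ ≤ supportFun Q u + ‖u‖ * dist P Q := by rw [← dist_eq_norm]; gcongr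

theorem continuous_supportFun (u : V) : Continuous fun P : ConvexBody V => supportFun P u :=
  (LipschitzWith.of_le_add_mul ‖u‖₊ fun P Q => supportFun_le_add_norm_mul_dist P Q u).continuous

theorem mem_of_forall_inner_le_supportFun {z : V} (h : ∀ u, ⟪u, z⟫ ≤ supportFun P u) : z ∈ P := by
  obtain ⟨p, hp, h_dist⟩ := exists_norm_eq_iInf_of_complete_convex P.nonempty
    P.isCompact.isComplete P.convex z
  have h_obtuse := (norm_eq_iInf_iff_real_inner_le_zero P.convex hp).mp h_dist
  obtain ⟨x, hx, hux⟩ := exists_inner_eq_supportFun P (z - p)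
  have h_le : ⟪z - p, z - p⟫ ≤ 0 :=
    calc ⟪z - p, z - p⟫ = ⟪z - p, z⟫ - ⟪z - p, p⟫ := inner_sub_right _ _ _
      _ ≤ ⟪z - p, x⟫ - ⟪z - p, p⟫ := sub_le_sub_right (hux ▸ h _) _
      _ = ⟪z - p, x - p⟫ := (inner_sub_right _ _ _).symm
      _ ≤ 0 := h_obtuse x hx
  rwa [sub_eq_zero.mp (real_inner_self_nonpos.mp h_le)]

theorem inner_add_mul_norm_le_supportFun {z : V} {r : ℝ} (hr : 0 ≤ r) (h : closedBall z r ⊆ P)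
    (u : V) : ⟪u, z⟫ + r * ‖u‖ ≤ supportFun P u := by
  rcases eq_or_ne u 0 with rfl | hu
  · simpa using inner_le_supportFun (h (mem_closedBall_self hr)) 0
  · have hu' : ‖u‖ ≠ 0 := norm_ne_zero_iff.mpr hu
    have h_mem : z + (r / ‖u‖) • u ∈ closedBall z r := by
      rw [mem_closedBall, dist_self_add_left, norm_smul, norm_div, norm_norm,
        div_mul_cancel₀ _ hu', Real.norm_of_nonneg hr]
    calc ⟪u, z⟫ + r * ‖u‖ = ⟪u, z + (r / ‖u‖) • u⟫ := by
          rw [inner_add_right, real_inner_smul_right, real_inner_self_eq_norm_sq]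
          field_simp
      _ ≤ supportFun P u := inner_le_supportFun (h h_mem) u

theorem mem_of_closedBall_subset_of_dist_le {z : V} {r : ℝ} (h : closedBall z r ⊆ P)
    (hPQ : dist P Q ≤ r) : z ∈ Q :=
  mem_of_forall_inner_le_supportFun fun u => by
    have h_ball := inner_add_mul_norm_le_supportFun (dist_nonneg.trans hPQ) h u
    have h_dist := supportFun_le_add_norm_mul_dist P Q u
    linarith [mul_le_mul_of_nonneg_left hPQ (norm_nonneg u)]

theorem eventually_closedBall_subset {c : V} {r R : ℝ} (h : closedBall c R ⊆ P) (hr : r < R) :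
    ∀ᶠ Q : ConvexBody V in 𝓝 P, closedBall c r ⊆ (Q : Set V) := by
  filter_upwards [closedBall_mem_nhds P (sub_pos.mpr hr)] with Q hQ z hz
  refine mem_of_closedBall_subset_of_dist_le (r := R - r) ?_ (mem_closedBall'.mp hQ)
  exact (closedBall_subset_closedBall' (by linarith [mem_closedBall.mp hz])).trans h

end Support

end ConvexBodies

section SymmDiff

open Filter Metric Topology

section NormedSpace

variable {E : Type*} [NormedAddCommGroup E] [NormedSpace ℝ E]

theorem isCompact_frontier (P : ConvexBody E) : IsCompact (frontier (P : Set E)) :=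
  P.isCompact.of_isClosed_subset isClosed_frontier P.isClosed.frontier_subset

theorem measure_sdiff_ne_top [MeasurableSpace E] (μ : Measure E) [IsFiniteMeasureOnCompacts μ]
    (P Q : ConvexBody E) : μ (P \ Q : Set E) ≠ ⊤ :=
  measure_ne_top_of_subset Set.sdiff_subset P.isCompact.measure_lt_top.ne

theorem ball_lineMap_subset {s : Set E} (hs : Convex ℝ s) {c x : E} {r l : ℝ}
    (hc : ball c r ⊆ s) (hx : x ∈ s) (hl0 : 0 < l) (hl1 : l ≤ 1) :
    ball (AffineMap.lineMap x c l) (l * r) ⊆ s := by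
  intro y hy
  have h_mem : c + l⁻¹ • (y - AffineMap.lineMap x c l) ∈ s := by
    refine hc ?_
    rw [mem_ball, dist_self_add_left, norm_smul, Real.norm_of_nonneg (inv_pos.mpr hl0).le,
      inv_mul_lt_iff₀ hl0, ← dist_eq_norm]
    exact hy
  have h_eq : AffineMap.lineMap x (c + l⁻¹ • (y - AffineMap.lineMap x c l)) l = y := by
    simp only [AffineMap.lineMap_apply_module, smul_add, smul_inv_smul₀ hl0.ne']
    module
  exact h_eq ▸ hs.lineMap_mem hx h_mem ⟨hl0.le, hl1⟩

theorem convexBody_dist_le_of_lineMap_mem {P Q : ConvexBody E} {c : E} {D l : ℝ}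
    (hl0 : 0 ≤ l) (hl1 : l ≤ 1 / 2) (hD : (P : Set E) ⊆ closedBall c D)
    (hP : ∀ x ∈ P, AffineMap.lineMap x c l ∈ Q) (hQ : ∀ y ∈ Q, AffineMap.lineMap y c l ∈ P) :
    dist P Q ≤ l * (2 * D) := by
  have hD0 : 0 ≤ D := P.nonempty.elim fun x hx => dist_nonneg.trans (mem_closedBall.mp (hD hx))
  refine convexBody_dist_le (by positivity) (fun x hx => ⟨_, hP x hx, ?_⟩)
    (fun y hy => ⟨_, hQ y hy, ?_⟩)
  · rw [dist_left_lineMap, Real.norm_of_nonneg hl0]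
    have hx_dist : dist x c ≤ D := hD hx
    gcongr
    linarith
  · rw [dist_left_lineMap, Real.norm_of_nonneg hl0]
    have hy_dist : (1 - l) * dist y c ≤ D := by
      have h := mem_closedBall.mp (hD (hQ y hy))
      rwa [dist_lineMap_right, Real.norm_of_nonneg (by linarith)] at h
    gcongr
    nlinarith [dist_nonneg (x := y) (y := c)]

variable [FiniteDimensional ℝ E]

theorem exists_mem_frontier_dist_le {s : Set E} {x y : E} (hx : x ∈ s) (hy : y ∉ s) :
    ∃ z ∈ frontier s, dist x z ≤ dist x y := by
  obtain ⟨z, hz, hxz⟩ := exists_mem_frontier_infDist_compl_eq_dist hx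
    (Set.ne_univ_iff_exists_notMem s |>.mpr ⟨y, hy⟩)
  exact ⟨z, hz, hxz ▸ infDist_le_dist_of_mem hy⟩

end NormedSpace

variable {V : Type*} [NormedAddCommGroup V] [InnerProductSpace ℝ V] [FiniteDimensional ℝ V]
  {P Q : ConvexBody V}

theorem sdiff_subset_cthickening_frontier_left (P Q : ConvexBody V) :
    (P \ Q : Set V) ⊆ cthickening (dist P Q) (frontier P) := by
  rintro x ⟨hxP, hxQ⟩
  obtain ⟨y, hy, hyP⟩ := Set.not_subset.mp fun h =>
    hxQ (mem_of_closedBall_subset_of_dist_le (r := dist P Q) h le_rfl)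
  obtain ⟨z, hz, hxz⟩ := exists_mem_frontier_dist_le hxP hyP
  exact mem_cthickening_of_dist_le _ z _ _ hz (hxz.trans (mem_closedBall'.mp hy))

theorem sdiff_subset_cthickening_frontier_right (P Q : ConvexBody V) :
    (Q \ P : Set V) ⊆ cthickening (dist P Q) (frontier P) := by
  rintro x ⟨hxQ, hxP⟩
  obtain ⟨y, hy, hxy⟩ := exists_mem_dist_le_dist Q P hxQ
  obtain ⟨z, hz, hxz⟩ := exists_mem_frontier_dist_le (s := (P : Set V)ᶜ) hxP (not_not.mpr hy)
  rw [frontier_compl] at hz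
  exact mem_cthickening_of_dist_le _ z _ _ hz (hxz.trans (dist_comm P Q ▸ hxy))

variable [MeasurableSpace V] [BorelSpace V] (μ : Measure V) [μ.IsAddHaarMeasure]

theorem measureReal_sdiff_add_sdiff_le (P Q : ConvexBody V) :
    μ.real (Q \ P : Set V) + μ.real (P \ Q : Set V) ≤
      μ.real (cthickening (dist P Q) (frontier P)) := by
  have h_compact : IsCompact (cthickening (dist P Q) (frontier (P : Set V))) :=
    (isCompact_frontier P).cthickening
  rw [← measureReal_union disjoint_sdiff_sdiff (P.isClosed.measurableSet.diff
    Q.isClosed.measurableSet) (measure_sdiff_ne_top μ Q P) (measure_sdiff_ne_top μ P Q)]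
  exact measureReal_mono (Set.union_subset (sdiff_subset_cthickening_frontier_right P Q)
    (sdiff_subset_cthickening_frontier_left P Q)) h_compact.measure_lt_top.ne

theorem tendsto_measureReal_sdiff_add_sdiff (P : ConvexBody V) :
    Tendsto (fun Q : ConvexBody V => μ.real (Q \ P : Set V) + μ.real (P \ Q : Set V)) (𝓝 P)
      (𝓝 0) := by
  have h_frontier : Tendsto (fun r => μ.real (cthickening r (frontier (P : Set V)))) (𝓝 0)
      (𝓝 0) := by
    have h := (ENNReal.tendsto_toReal (isCompact_frontier P).measure_lt_top.ne).comp
      (tendsto_measure_cthickening_of_isCompact (μ := μ) (isCompact_frontier P))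
    rwa [P.convex.addHaar_frontier μ] at h
  have h_dist : Tendsto (fun Q => dist P Q) (𝓝 P) (𝓝 0) :=
    tendsto_iff_dist_tendsto_zero.mp tendsto_id |>.congr fun Q => dist_comm Q P
  exact squeeze_zero (fun _ => by positivity) (measureReal_sdiff_add_sdiff_le μ P)
    (h_frontier.comp h_dist)

/-- At least half of a ball centred outside `Q` is outside `Q`, because the reflection in the centre
maps the part of the ball in `Q` into the complement of `Q`. -/
theorem measureReal_ball_le_two_mul_sdiff {z : V} {r : ℝ} (hP : ball z r ⊆ P) (hz : z ∉ Q) :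
    μ.real (ball 0 r) ≤ 2 * μ.real (P \ Q : Set V) := by
  have h_reflect : (fun x => z + z - x) ⁻¹' (ball z r ∩ Q) ⊆ (P \ Q : Set V) := by
    rintro x ⟨hx_ball, hxQ⟩
    replace hx_ball : x ∈ ball z r := by
      simpa [mem_ball, dist_eq_norm, norm_sub_rev, sub_sub_eq_add_sub, add_sub_right_comm]
        using hx_ball
    refine ⟨hP hx_ball, fun hx => hz ?_⟩
    have h_mid := Q.convex.midpoint_mem hx hxQ
    rwa [midpoint_eq_smul_add, add_sub_cancel, ← two_smul ℝ z, smul_smul, invOf_mul_self,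
      one_smul] at h_mid
  have h_inter : μ.real (ball z r ∩ Q) ≤ μ.real (P \ Q : Set V) := by
    rw [← (Measure.measurePreserving_sub_left μ (z + z)).measureReal_preimage
      (measurableSet_ball.inter Q.isClosed.measurableSet).nullMeasurableSet]
    exact measureReal_mono h_reflect (measure_sdiff_ne_top μ P Q)
  calc μ.real (ball 0 r) = μ.real (ball z r) := by
        rw [measureReal_def, measureReal_def, Measure.addHaar_ball_center μ z]
    _ = μ.real (ball z r ∩ Q) + μ.real (ball z r \ Q) :=
      (measureReal_inter_add_sdiff Q.isClosed.measurableSet measure_ball_lt_top.ne).symm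
    _ ≤ μ.real (P \ Q : Set V) + μ.real (P \ Q : Set V) :=
      add_le_add h_inter
        (measureReal_mono (Set.sdiff_subset_sdiff_left hP) (measure_sdiff_ne_top μ P Q))
    _ = 2 * μ.real (P \ Q : Set V) := (two_mul _).symm

variable {μ}

theorem closedBall_subset_of_two_mul_sdiff_lt {c : V} {r : ℝ} (hP : closedBall c (r + r) ⊆ P)
    (hPQ : 2 * μ.real (P \ Q : Set V) < μ.real (ball 0 r)) : closedBall c r ⊆ Q := by
  intro z hz
  by_contra hzQ
  have h_ball : ball z r ⊆ P :=
    (ball_subset_closedBall.trans (closedBall_subset_closedBall' (by gcongr; exact hz))).trans hP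
  exact hPQ.not_ge (measureReal_ball_le_two_mul_sdiff μ h_ball hzQ)

theorem lineMap_mem_of_two_mul_sdiff_lt {c x : V} {r l : ℝ} (hP : ball c r ⊆ P) (hx : x ∈ P)
    (hl0 : 0 < l) (hl1 : l ≤ 1) (hPQ : 2 * μ.real (P \ Q : Set V) < μ.real (ball 0 (l * r))) :
    AffineMap.lineMap x c l ∈ Q := by
  by_contra hzQ
  exact hPQ.not_ge
    (measureReal_ball_le_two_mul_sdiff μ (ball_lineMap_subset P.convex hP hx hl0 hl1) hzQ)

theorem dist_le_of_two_mul_sdiff_lt {c : V} {r D l : ℝ} (hr : 0 < r) (hl0 : 0 < l)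
    (hl1 : l ≤ 1 / 2) (h_ball : closedBall c (r + r) ⊆ P) (hD : (P : Set V) ⊆ closedBall c D)
    (h_PQ : 2 * μ.real (P \ Q : Set V) < μ.real (ball 0 (l * r)))
    (h_QP : 2 * μ.real (Q \ P : Set V) < μ.real (ball 0 (l * r))) : dist P Q ≤ l * (2 * D) := by
  have h_mono : ∀ {s : ℝ}, l * r ≤ s → μ.real (ball 0 (l * r)) ≤ μ.real (ball (0 : V) s) :=
    fun h => measureReal_mono (ball_subset_ball h) measure_ball_lt_top.ne
  have h_ballQ : closedBall c r ⊆ Q :=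
    closedBall_subset_of_two_mul_sdiff_lt h_ball (h_PQ.trans_le (h_mono (by nlinarith)))
  refine convexBody_dist_le_of_lineMap_mem hl0.le hl1 hD (fun x hx => ?_) fun y hy => ?_
  · exact lineMap_mem_of_two_mul_sdiff_lt (ball_subset_closedBall.trans h_ball) hx hl0
      (by linarith) (h_PQ.trans_le (h_mono (by nlinarith)))
  · exact lineMap_mem_of_two_mul_sdiff_lt (ball_subset_closedBall.trans h_ballQ) hy hl0
      (by linarith) h_QP

variable (μ)

theorem exists_dist_lt_of_sdiff_add_sdiff_lt (hP : (interior (P : Set V)).Nonempty) {ε : ℝ}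
    (hε : 0 < ε) : ∃ δ > 0, ∀ Q : ConvexBody V,
      μ.real (Q \ P : Set V) + μ.real (P \ Q : Set V) < δ → dist Q P < ε := by
  obtain ⟨c, hc⟩ := hP
  obtain ⟨R, hR, h_ball⟩ := nhds_basis_closedBall.mem_iff.mp (mem_interior_iff_mem_nhds.mp hc)
  obtain ⟨r, rfl⟩ : ∃ r, R = r + r := ⟨R / 2, (add_halves R).symm⟩
  have hr : 0 < r := by linarith
  obtain ⟨D, hD⟩ := P.isBounded.subset_closedBall c
  have hD0 : 0 ≤ D := dist_nonneg.trans (hD (interior_subset hc))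
  obtain ⟨l, hl0, hl1, hlε⟩ : ∃ l : ℝ, 0 < l ∧ l ≤ 1 / 2 ∧ l * (2 * D) < ε := by
    refine ⟨ε / (2 * (D + ε)), by positivity, ?_, ?_⟩
    · rw [div_le_iff₀ (by positivity)]
      linarith
    · rw [div_mul_eq_mul_div, div_lt_iff₀ (by positivity)]
      nlinarith
  have h_pos : 0 < μ.real (ball (0 : V) (l * r)) :=
    ENNReal.toReal_pos (measure_ball_pos μ 0 (by positivity)).ne' measure_ball_lt_top.ne
  refine ⟨μ.real (ball (0 : V) (l * r)) / 2, half_pos h_pos, fun Q hQ => ?_⟩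
  have h_PQ := measureReal_nonneg (μ := μ) (s := (P \ Q : Set V))
  have h_QP := measureReal_nonneg (μ := μ) (s := (Q \ P : Set V))
  rw [dist_comm]
  exact (dist_le_of_two_mul_sdiff_lt hr hl0 hl1 h_ball hD (by linarith) (by linarith)).trans_lt hlε

theorem IsDelzant.interior_nonempty {n : ℕ} {P : ConvexBody (EuclideanSpace ℝ (Fin n))}
    (hP : IsDelzant P) : (interior (P : Set (EuclideanSpace ℝ (Fin n)))).Nonempty :=
  P.convex.interior_nonempty_iff_affineSpan_eq_top.mpr hP.2.1

theorem hausdorffTopology_eq_symmDiffTopology (n : ℕ) :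
    hausdorffTopology n = symmDiffTopology n := by
  refine TopologicalSpace.ext_nhds fun P => ?_
  refine (@nhds_basis_ball _ (hausdorffMetric n) P).ext (@nhds_basis_ball _ (symmDiffMetric n) P)
    (fun ε hε => ?_) (fun ε hε => ?_)
  · obtain ⟨δ, hδ, h⟩ := exists_dist_lt_of_sdiff_add_sdiff_lt volume P.2.interior_nonempty hε
    exact ⟨δ, hδ, fun Q hQ => (ConvexBody.hausdorffDist_coe Q.1 P.1).trans_lt (h Q.1 hQ)⟩
  · obtain ⟨δ, hδ, h⟩ := Metric.eventually_nhds_iff.mp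
      ((tendsto_measureReal_sdiff_add_sdiff volume P.1).eventually_lt_const hε)
    exact ⟨δ, hδ, fun Q hQ => h ((ConvexBody.hausdorffDist_coe Q.1 P.1).symm.trans_lt hQ)⟩

end SymmDiff

section NormalFan

open Filter Topology Pointwise
open scoped RealInnerProductSpace

variable {n : ℕ} {P Q : ConvexBody (EuclideanSpace ℝ (Fin n))} {α β : EuclideanSpace ℝ (Fin n)}

/-- The cone of the normal fan of `P` that contains `α` in its relative interior. -/
def localCone (P : ConvexBody (EuclideanSpace ℝ (Fin n))) (α : EuclideanSpace ℝ (Fin n)) :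
    Set (EuclideanSpace ℝ (Fin n)) :=
  normalCone (P : Set (EuclideanSpace ℝ (Fin n))) (face P α)

theorem mem_localCone_iff_forall_inner_le : β ∈ localCone P α ↔
    ∀ p ∈ P, ⟪α, p⟫ = supportFun P α → ∀ x ∈ P, ⟪β, x⟫ ≤ ⟪β, p⟫ :=
  ⟨fun h _ hp hα => (h ⟨hp, (inner_eq_supportFun_iff hp).mp hα⟩).2, fun h _ hp =>
    ⟨hp.1, h _ hp.1 ((inner_eq_supportFun_iff (P := P) hp.1).mpr hp.2)⟩⟩

theorem mem_localCone : β ∈ localCone P α ↔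
    ∀ p ∈ P, ⟪α, p⟫ = supportFun P α → ⟪β, p⟫ = supportFun P β :=
  mem_localCone_iff_forall_inner_le.trans <| forall₃_congr fun _ hp _ =>
    (inner_eq_supportFun_iff hp).symm

theorem self_mem_localCone (P : ConvexBody (EuclideanSpace ℝ (Fin n)))
    (α : EuclideanSpace ℝ (Fin n)) : α ∈ localCone P α :=
  mem_localCone.mpr fun _ _ h => h

theorem localCone_subset_localCone (h : β ∈ localCone P α) : localCone P β ⊆ localCone P α :=
  fun _ hγ => mem_localCone.mpr fun p hp hα =>
    mem_localCone.mp hγ p hp (mem_localCone.mp h p hp hα)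

theorem sum_smul_mem_localCone {ι : Type*} [Fintype ι] {v : ι → EuclideanSpace ℝ (Fin n)}
    (hv : ∀ i, v i ∈ localCone P α) {a : ι → ℝ} (ha : ∀ i, 0 ≤ a i) :
    ∑ i, a i • v i ∈ localCone P α := by
  refine mem_localCone_iff_forall_inner_le.mpr fun p hp hα x hx => ?_
  simp only [sum_inner, real_inner_smul_left]
  exact Finset.sum_le_sum fun i _ => mul_le_mul_of_nonneg_left
    (mem_localCone_iff_forall_inner_le.mp (hv i) p hp hα x hx) (ha i)

theorem smul_mem_localCone (hβ : β ∈ localCone P α) {c : ℝ} (hc : 0 ≤ c) :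
    c • β ∈ localCone P α := by
  simpa using sum_smul_mem_localCone (fun _ : Unit => hβ) fun _ => hc

theorem mem_localCone_add {s t : ℝ} (h : β ∈ localCone P α) (hs : 0 < s) (ht : 0 ≤ t) :
    α ∈ localCone P (s • α + t • β) := by
  refine mem_localCone_iff_forall_inner_le.mpr fun q hq h_max x hx => ?_
  obtain ⟨p, hp, hαp⟩ := exists_inner_eq_supportFun P α
  have h_le := (inner_eq_supportFun_iff hq).mp h_max p hp
  simp only [inner_add_left, real_inner_smul_left, hαp, mem_localCone.mp h p hp hαp] at h_le
  have hβq := mul_le_mul_of_nonneg_left (inner_le_supportFun hq β) ht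
  exact (inner_le_supportFun hx α).trans (le_of_mul_le_mul_left (by linarith) hs)

theorem supportFun_add_right_eq_iff :
    supportFun P (α + β) = supportFun P α + supportFun P β ↔
      α ∈ localCone P (α + β) ∧ β ∈ localCone P (α + β) := by
  constructor
  · intro h
    have h_eq : ∀ p ∈ P, ⟪α + β, p⟫ = supportFun P (α + β) →
        ⟪α, p⟫ = supportFun P α ∧ ⟪β, p⟫ = supportFun P β := fun p hp hαβ => by
      have hα := inner_le_supportFun hp α
      have hβ := inner_le_supportFun hp β
      rw [h, inner_add_left] at hαβ
      constructor <;> linarith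
    exact ⟨mem_localCone.mpr fun p hp hαβ => (h_eq p hp hαβ).1,
      mem_localCone.mpr fun p hp hαβ => (h_eq p hp hαβ).2⟩
  · rintro ⟨hα, hβ⟩
    obtain ⟨p, hp, hαβ⟩ := exists_inner_eq_supportFun P (α + β)
    rw [← mem_localCone.mp hα p hp hαβ, ← mem_localCone.mp hβ p hp hαβ, ← hαβ, inner_add_left]

theorem localCone_add (P Q : ConvexBody (EuclideanSpace ℝ (Fin n)))
    (α : EuclideanSpace ℝ (Fin n)) : localCone (P + Q) α = localCone P α ∩ localCone Q α := by
  ext β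
  have h_iff : ∀ p ∈ P, ∀ q ∈ Q, ∀ γ : EuclideanSpace ℝ (Fin n),
      ⟪γ, p + q⟫ = supportFun (P + Q) γ ↔ ⟪γ, p⟫ = supportFun P γ ∧ ⟪γ, q⟫ = supportFun Q γ :=
    fun p hp q hq γ => by
      have hP := inner_le_supportFun hp γ
      have hQ := inner_le_supportFun hq γ
      rw [supportFun_add, inner_add_right]
      exact ⟨fun h => ⟨by linarith, by linarith⟩, fun h => by rw [h.1, h.2]⟩
  simp only [Set.mem_inter_iff, mem_localCone]
  constructor
  · intro h
    obtain ⟨p, hp, hαp⟩ := exists_inner_eq_supportFun P α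
    obtain ⟨q, hq, hαq⟩ := exists_inner_eq_supportFun Q α
    exact ⟨fun x hx hαx => ((h_iff x hx q hq β).mp
        (h (x + q) (Set.add_mem_add hx hq) ((h_iff x hx q hq α).mpr ⟨hαx, hαq⟩))).1,
      fun y hy hαy => ((h_iff p hp y hy β).mp
        (h (p + y) (Set.add_mem_add hp hy) ((h_iff p hp y hy α).mpr ⟨hαp, hαy⟩))).2⟩
  · rintro ⟨hβP, hβQ⟩ _ ⟨p, hp, q, hq, rfl⟩ hα
    obtain ⟨hαp, hαq⟩ := (h_iff p hp q hq α).mp hα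
    exact (h_iff p hp q hq β).mpr ⟨hβP p hp hαp, hβQ q hq hαq⟩

theorem localCone_smul (P : ConvexBody (EuclideanSpace ℝ (Fin n))) {c : ℝ} (hc : 0 < c)
    (α : EuclideanSpace ℝ (Fin n)) : localCone (c • P) α = localCone P α := by
  ext β
  simp only [mem_localCone, ← SetLike.mem_coe, ConvexBody.coe_smul, Set.forall_mem_image,
    ← Set.image_smul, supportFun_smul P hc.le, real_inner_smul_right, mul_right_inj' hc.ne']

theorem localCone_sum {ι : Type*} (s : Finset ι) (K : ι → ConvexBody (EuclideanSpace ℝ (Fin n)))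
    (α : EuclideanSpace ℝ (Fin n)) :
    localCone (∑ i ∈ s, K i) α = ⋂ i ∈ s, localCone (K i) α := by
  classical
  induction s using Finset.induction_on with
  | empty =>
    ext β
    simp [mem_localCone_iff_forall_inner_le, ← SetLike.mem_coe]
  | insert i s hi ih => rw [Finset.sum_insert hi, localCone_add, ih, Finset.set_biInter_insert]

theorem localCone_zero (P : ConvexBody (EuclideanSpace ℝ (Fin n))) : localCone P 0 =
    ((vectorSpan ℝ (P : Set (EuclideanSpace ℝ (Fin n))))ᗮ : Set (EuclideanSpace ℝ (Fin n))) := by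
  ext β
  have h_zero : ∀ p ∈ P, ⟪(0 : EuclideanSpace ℝ (Fin n)), p⟫ = supportFun P 0 := fun p hp =>
    (inner_eq_supportFun_iff hp).mpr fun x _ => by simp
  rw [mem_localCone_iff_forall_inner_le, vectorSpan_def, SetLike.mem_coe,
    ← Submodule.span_singleton_le_iff_mem, Submodule.le_orthogonal_iff_le_orthogonal,
    Submodule.span_le, Set.vsub_subset_iff]
  simp only [SetLike.mem_coe, Submodule.mem_orthogonal_singleton_iff_inner_right, vsub_eq_sub,
    inner_sub_right, sub_eq_zero]
  exact ⟨fun h x hx y hy => (h y hy (h_zero y hy) x hx).antisymm (h x hx (h_zero x hx) y hy),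
    fun h p hp _ x hx => (h x hx p hp).le⟩

theorem affineSpan_eq_top_iff_localCone_zero_subset (P : ConvexBody (EuclideanSpace ℝ (Fin n))) :
    affineSpan ℝ (P : Set (EuclideanSpace ℝ (Fin n))) = ⊤ ↔ localCone P 0 ⊆ {0} := by
  rw [AffineSubspace.affineSpan_eq_top_iff_vectorSpan_eq_top_of_nonempty ℝ _ _ P.nonempty,
    localCone_zero, ← Submodule.orthogonal_eq_bot_iff, Submodule.eq_bot_iff]
  rfl

theorem exists_common_maximizer_of_eq_convexHull {S : Finset (EuclideanSpace ℝ (Fin n))}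
    (hS : (P : Set (EuclideanSpace ℝ (Fin n))) = convexHull ℝ (S : Set (EuclideanSpace ℝ (Fin n))))
    (α β : EuclideanSpace ℝ (Fin n)) : ∃ ε > (0 : ℝ), ∃ p ∈ S, ⟪α, p⟫ = supportFun P α ∧
      ⟪α + ε • β, p⟫ = supportFun P (α + ε • β) := by
  have h_mem : ∀ p ∈ S, p ∈ P := fun p hp => hS.ge (subset_convexHull ℝ _ hp)
  have h_max : ∀ γ : EuclideanSpace ℝ (Fin n), ∃ p ∈ S, ⟪γ, p⟫ = supportFun P γ := fun γ => by
    obtain ⟨x, hx, hγx⟩ := exists_inner_eq_supportFun P γ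
    obtain ⟨p, hp, hxp⟩ := ((innerₗ _ γ).convexOn convex_univ).exists_ge_of_mem_convexHull
      (Set.subset_univ _) (hS.le hx)
    exact ⟨p, hp, (inner_le_supportFun (h_mem p hp) γ).antisymm (hγx ▸ hxp)⟩
  obtain ⟨q, hq, hαq⟩ := h_max α
  have h_near : ∀ᶠ ε : ℝ in 𝓝 0, ∀ p ∈ S, ⟪α, p⟫ < ⟪α, q⟫ →
      ⟪α + ε • β, p⟫ < ⟪α + ε • β, q⟫ := by
    refine (Filter.eventually_all_finset S).mpr fun p _ => eventually_imp_distrib_left.mpr ?_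
    intro hpq
    refine ContinuousAt.eventually_lt (by fun_prop) (by fun_prop) ?_
    simpa using hpq
  obtain ⟨ε, h, hε⟩ := ((eventually_nhdsWithin_of_eventually_nhds h_near).and
    (self_mem_nhdsWithin (s := Set.Ioi (0 : ℝ)))).exists
  obtain ⟨p, hp, hεp⟩ := h_max (α + ε • β)
  refine ⟨ε, hε, p, hp, by_contra fun h_ne => ?_, hεp⟩
  have h_lt := h p hp (hαq ▸ (inner_le_supportFun (h_mem p hp) α).lt_of_ne h_ne)
  exact h_lt.not_ge (hεp ▸ inner_le_supportFun (h_mem q hq) _)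

theorem mem_localCone_iff_of_eq_convexHull {S : Finset (EuclideanSpace ℝ (Fin n))}
    (hS : (P : Set (EuclideanSpace ℝ (Fin n))) =
      convexHull ℝ (S : Set (EuclideanSpace ℝ (Fin n)))) :
    β ∈ localCone P α ↔ ∀ p ∈ S, ⟪α, p⟫ = supportFun P α → ⟪β, p⟫ = supportFun P β := by
  refine ⟨fun h p hp => mem_localCone.mp h p (hS.ge (subset_convexHull ℝ _ hp)),
    fun h => mem_localCone.mpr fun q hq hαq => ?_⟩
  obtain ⟨ε, hε, p, hp, hαp, hεp⟩ := exists_common_maximizer_of_eq_convexHull hS α (-β)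
  have h_le := hεp ▸ inner_le_supportFun hq (α + ε • -β)
  simp only [inner_add_left, real_inner_smul_left, inner_neg_left, hαp, hαq, h p hp hαp] at h_le
  exact (inner_le_supportFun hq β).antisymm (le_of_mul_le_mul_left (by linarith) hε)

/-- The body `P` is a convex polytope. -/
def IsPolytope (P : ConvexBody (EuclideanSpace ℝ (Fin n))) : Prop :=
  ∃ S : Finset (EuclideanSpace ℝ (Fin n)),
    (P : Set (EuclideanSpace ℝ (Fin n))) = convexHull ℝ (S : Set (EuclideanSpace ℝ (Fin n)))

namespace IsPolytope

theorem add (hP : IsPolytope P) (hQ : IsPolytope Q) : IsPolytope (P + Q) := by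
  classical
  obtain ⟨S, hS⟩ := hP
  obtain ⟨T, hT⟩ := hQ
  exact ⟨S + T, by rw [ConvexBody.coe_add, hS, hT, Finset.coe_add, convexHull_add]⟩

theorem smul (hP : IsPolytope P) (c : ℝ) : IsPolytope (c • P) := by
  classical
  obtain ⟨S, hS⟩ := hP
  exact ⟨c • S, by rw [ConvexBody.coe_smul, hS, Finset.coe_smul_finset, convexHull_smul]⟩

theorem sum {ι : Type*} (s : Finset ι) {K : ι → ConvexBody (EuclideanSpace ℝ (Fin n))}
    (h : ∀ i ∈ s, IsPolytope (K i)) : IsPolytope (∑ i ∈ s, K i) :=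
  Finset.sum_induction K IsPolytope (fun _ _ => add) ⟨{0}, by simp [Set.singleton_zero]⟩ h

theorem exists_sub_smul_mem_localCone (hP : IsPolytope P) (hβ : β ∈ localCone P α) :
    ∃ ε > (0 : ℝ), α - ε • β ∈ localCone P α := by
  obtain ⟨S, hS⟩ := hP
  obtain ⟨ε, hε, p, hpS, hαp, hεp⟩ := exists_common_maximizer_of_eq_convexHull hS α (-β)
  have hp : p ∈ P := hS.ge (subset_convexHull ℝ _ hpS)
  rw [smul_neg, ← sub_eq_add_neg] at hεp
  refine ⟨ε, hε, mem_localCone.mpr fun q hq hαq => ?_⟩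
  rw [← hεp, inner_sub_left, inner_sub_left, hαq, hαp, real_inner_smul_left, real_inner_smul_left,
    mem_localCone.mp hβ p hp hαp, mem_localCone.mp hβ q hq hαq]

theorem finite_normalFan (hP : IsPolytope P) :
    (normalFan (P : Set (EuclideanSpace ℝ (Fin n)))).Finite := by
  obtain ⟨S, hS⟩ := hP
  refine ((S : Set _).toFinite.finite_subsets.image fun T : Set (EuclideanSpace ℝ (Fin n)) =>
    {β | ∀ p ∈ T, ⟪β, p⟫ = supportFun P β}).subset ?_
  rintro _ ⟨α, rfl⟩
  refine ⟨{p | p ∈ S ∧ ⟪α, p⟫ = supportFun P α}, fun p hp => hp.1, ?_⟩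
  ext β
  exact (forall_congr' fun p => and_imp).trans (mem_localCone_iff_of_eq_convexHull hS).symm

end IsPolytope

theorem mem_coneOf_self {m : ℕ} (v : Fin m → EuclideanSpace ℝ (Fin n)) (i : Fin m) :
    v i ∈ coneOf v :=
  ⟨Pi.single i 1, fun j => by rw [Pi.single_apply]; positivity, by simp [Pi.single_apply]⟩

theorem coneOf_subset_localCone {m : ℕ} {v : Fin m → EuclideanSpace ℝ (Fin n)}
    (hv : ∀ i, v i ∈ localCone P α) : coneOf v ⊆ localCone P α := by
  rintro _ ⟨a, ha, rfl⟩
  exact sum_smul_mem_localCone hv ha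

theorem IsPolytope.pos_of_localCone_eq_coneOf (hP : IsPolytope P) {m : ℕ}
    {v : Fin m → EuclideanSpace ℝ (Fin n)} (hv : LinearIndependent ℝ v)
    (h_cone : localCone P α = coneOf v) {a : Fin m → ℝ} (ha : α = ∑ i, a i • v i) (i : Fin m) :
    0 < a i := by
  obtain ⟨ε, hε, h⟩ := hP.exists_sub_smul_mem_localCone (h_cone ▸ mem_coneOf_self v i)
  obtain ⟨b, hb, h_eq⟩ := h_cone ▸ h
  have h_coeff : ∑ j, (a j - (Pi.single i ε : Fin m → ℝ) j) • v j = ∑ j, b j • v j := by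
    rw [← h_eq, ha]
    simp [sub_smul, Finset.sum_sub_distrib, Pi.single_apply]
  have h_i := congrFun (hv.fintypeLinearCombination_injective h_coeff) i
  rw [Pi.single_eq_same] at h_i
  linarith [hb i]

theorem isDelzant_iff : IsDelzant P ↔
    IsPolytope P ∧ localCone P 0 ⊆ {0} ∧ ∀ α, IsUnimodularCone (localCone P α) := by
  rw [← affineSpan_eq_top_iff_localCone_zero_subset]
  refine and_congr Iff.rfl (and_congr Iff.rfl ⟨fun h α => h _ ⟨α, rfl⟩, ?_⟩)
  rintro h _ ⟨α, rfl⟩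
  exact h α

/-- The normal fan of `P` refines the normal fan of `Q`. -/
def Refines (P Q : ConvexBody (EuclideanSpace ℝ (Fin n))) : Prop :=
  ∀ α, localCone P α ⊆ localCone Q α

theorem localCone_minkowskiComb (P Q : ConvexBody (EuclideanSpace ℝ (Fin n))) {t : ℝ}
    (ht : t ∈ Set.Ioo 0 1) (α : EuclideanSpace ℝ (Fin n)) :
    localCone (minkowskiComb P Q t) α = localCone P α ∩ localCone Q α := by
  rw [minkowskiComb, localCone_add, localCone_smul _ (sub_pos.mpr ht.2), localCone_smul _ ht.1]

theorem Refines.minkowskiComb {Z : ConvexBody (EuclideanSpace ℝ (Fin n))} (hP : Refines Z P)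
    (hQ : Refines Z Q) {t : ℝ} (ht : t ∈ Set.Icc 0 1) : Refines Z (minkowskiComb P Q t) :=
  minkowskiComb_induction hP hQ (fun _ ht α => localCone_minkowskiComb P Q ht α ▸
    Set.subset_inter (hP α) (hQ α)) ht

theorem IsDelzant.minkowskiComb (hP : IsDelzant P) (hQ : IsDelzant Q) (h : Refines P Q) {t : ℝ}
    (ht : t ∈ Set.Icc 0 1) : IsDelzant (minkowskiComb P Q t) := by
  refine minkowskiComb_induction hP hQ (fun t ht => ?_) ht
  rw [isDelzant_iff] at hP hQ ⊢
  have h_cone : ∀ α, localCone (DelzantModuli.minkowskiComb P Q t) α = localCone P α := fun α => by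
    rw [localCone_minkowskiComb P Q ht, Set.inter_eq_left.mpr (h α)]
  simp only [h_cone]
  exact ⟨(hP.1.smul _).add (hQ.1.smul _), hP.2⟩

end NormalFan

section NearbyDelzant

open Filter Topology
open scoped RealInnerProductSpace

variable {n : ℕ} {P Q : ConvexBody (EuclideanSpace ℝ (Fin n))} {r : EuclideanSpace ℝ (Fin n)}

theorem IsPrimitive.ne_zero {v : EuclideanSpace ℝ (Fin n)} (hv : IsPrimitive v) :
    v ≠ 0 := by
  rintro rfl
  obtain ⟨z, hz, h_gcd⟩ := hv
  have hz0 : Finset.univ.gcd z = 0 :=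
    Finset.gcd_eq_zero_iff.mpr fun i _ => by simpa using (hz i).symm
  exact zero_ne_one (hz0.symm.trans h_gcd)

theorem IsPrimitive.mem_integerLattice {v : EuclideanSpace ℝ (Fin n)} (hv : IsPrimitive v) :
    v ∈ integerLattice n :=
  let ⟨z, hz, _⟩ := hv
  fun i => ⟨z i, hz i⟩

theorem finite_integerLattice_norm_le (n : ℕ) (B : ℝ) :
    {w | w ∈ integerLattice n ∧ ‖w‖ ≤ B}.Finite := by
  refine ((Set.finite_Icc (fun _ : Fin n => -⌈B⌉) fun _ => ⌈B⌉).image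
    fun z => WithLp.toLp 2 fun i => (z i : ℝ)).subset ?_
  rintro w ⟨hw, hwB⟩
  choose z hz using hw
  have h_abs : ∀ i, |z i| ≤ ⌈B⌉ := fun i => by
    have h_coord : |w i| ≤ ⌈B⌉ := (PiLp.norm_apply_le w i).trans (hwB.trans (Int.le_ceil B))
    rwa [hz, ← Int.cast_abs, Int.cast_le] at h_coord
  refine ⟨z, ⟨fun i => (abs_le.mp (h_abs i)).1, fun i => (abs_le.mp (h_abs i)).2⟩, ?_⟩
  ext i
  exact (hz i).symm

theorem span_coneOf {m : ℕ} (v : Fin m → EuclideanSpace ℝ (Fin n)) :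
    Submodule.span ℝ (coneOf v) = Submodule.span ℝ (Set.range v) := by
  refine le_antisymm (Submodule.span_le.mpr ?_)
    (Submodule.span_mono (Set.range_subset_iff.mpr (mem_coneOf_self v)))
  rintro _ ⟨a, -, rfl⟩
  exact Submodule.sum_mem _ fun i _ => Submodule.smul_mem _ _
    (Submodule.subset_span (Set.mem_range_self i))

theorem coneMultiplicity_eq_one_iff {m : ℕ} {v : Fin m → EuclideanSpace ℝ (Fin n)} :
    coneMultiplicity v = 1 ↔ ∀ x ∈ Submodule.span ℝ (coneOf v), x ∈ integerLattice n →
      ∃ k : Fin m → ℤ, x = ∑ i, k i • v i := by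
  rw [coneMultiplicity, AddSubgroup.relIndex_eq_one]
  simp only [SetLike.le_def, AddSubgroup.mem_inf, Submodule.mem_toAddSubgroup, and_imp,
    AddSubgroup.mem_closure_range_iff_of_fintype]

theorem IsDelzant.exists_generators_sub_mem (hQ : IsDelzant Q) (hr : r ∈ integerLattice n) :
    ∃ (m : ℕ) (v : Fin m → EuclideanSpace ℝ (Fin n)), localCone Q r = coneOf v ∧
      ∀ i, v i ∈ integerLattice n ∧ r - v i ∈ localCone Q r := by
  rw [isDelzant_iff] at hQ
  obtain ⟨m, v, hv_prim, hv, h_cone, h_mult⟩ := hQ.2.2 r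
  obtain ⟨k, hk⟩ := coneMultiplicity_eq_one_iff.mp h_mult r
    (Submodule.subset_span (h_cone ▸ self_mem_localCone Q r)) hr
  simp only [← Int.cast_smul_eq_zsmul ℝ] at hk
  have hk_pos : ∀ i, 1 ≤ k i := fun i => Int.cast_pos.mp
    (hQ.1.pos_of_localCone_eq_coneOf hv h_cone hk i)
  refine ⟨m, v, h_cone, fun i => ⟨(hv_prim i).mem_integerLattice, ?_⟩⟩
  rw [h_cone]
  refine ⟨fun j => k j - (Pi.single i 1 : Fin m → ℝ) j, fun j => ?_, ?_⟩
  · have h_single : (Pi.single i 1 : Fin m → ℝ) j ≤ 1 := by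
      rw [Pi.single_apply]
      split_ifs <;> norm_num
    exact sub_nonneg.mpr (h_single.trans (by exact_mod_cast hk_pos j))
  · simp [hk, sub_smul, Finset.sum_sub_distrib, Pi.single_apply]

theorem mul_norm_le_of_mem_localCone {w c : EuclideanSpace ℝ (Fin n)} {ρ : ℝ} (hρ : 0 ≤ ρ)
    (h_ball : Metric.closedBall c ρ ⊆ Q) (hw : w ∈ localCone Q r) (hrw : r - w ∈ localCone Q r) :
    ρ * ‖w‖ ≤ supportFun Q r - ⟪r, c⟫ := by
  have h_add : supportFun Q (w + (r - w)) = supportFun Q w + supportFun Q (r - w) :=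
    supportFun_add_right_eq_iff.mpr (by rw [add_sub_cancel]; exact ⟨hw, hrw⟩)
  have hw_le := inner_add_mul_norm_le_supportFun hρ h_ball w
  have hc_le := inner_le_supportFun (h_ball (Metric.mem_closedBall_self hρ)) (r - w)
  rw [add_sub_cancel] at h_add
  rw [inner_sub_left] at hc_le
  linarith

theorem eventually_mem_localCone_of_sub_mem (P : ConvexBody (EuclideanSpace ℝ (Fin n)))
    (r w : EuclideanSpace ℝ (Fin n)) :
    ∀ᶠ Q in 𝓝 P, w ∈ localCone Q r → r - w ∈ localCone Q r → w ∈ localCone P r := by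
  have h_iff : ∀ Q : ConvexBody (EuclideanSpace ℝ (Fin n)),
      supportFun Q r = supportFun Q w + supportFun Q (r - w) ↔
        w ∈ localCone Q r ∧ r - w ∈ localCone Q r := fun Q => by
    simpa only [add_sub_cancel] using
      supportFun_add_right_eq_iff (P := Q) (α := w) (β := r - w)
  have h_closed : IsClosed {Q : ConvexBody (EuclideanSpace ℝ (Fin n)) |
      supportFun Q r = supportFun Q w + supportFun Q (r - w)} :=
    isClosed_eq (continuous_supportFun r)
      ((continuous_supportFun w).add (continuous_supportFun (r - w)))
  by_cases hP : w ∈ localCone P r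
  · exact .of_forall fun _ _ _ => hP
  · filter_upwards [h_closed.isOpen_compl.mem_nhds fun h => hP ((h_iff P).mp h).1]
      with Q hQ hw hrw
    exact absurd ((h_iff Q).mpr ⟨hw, hrw⟩) hQ

theorem eventually_localCone_subset (hP : IsDelzant P) (hr : r ∈ integerLattice n) :
    ∀ᶠ Q in 𝓝 P, IsDelzant Q → localCone Q r ⊆ localCone P r := by
  obtain ⟨c, hc⟩ := hP.interior_nonempty
  obtain ⟨ρ, hρ, h_ball⟩ := Metric.nhds_basis_closedBall.mem_iff.mp
    (mem_interior_iff_mem_nhds.mp hc)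
  have h_support : ∀ᶠ Q in 𝓝 P, supportFun Q r < supportFun P r + 1 :=
    (continuous_supportFun r).continuousAt.eventually_lt_const (lt_add_one _)
  filter_upwards [eventually_closedBall_subset h_ball (half_lt_self hρ), h_support,
    (finite_integerLattice_norm_le n ((supportFun P r + 1 - ⟪r, c⟫) / (ρ / 2))).eventually_all.mpr
      fun w _ => eventually_mem_localCone_of_sub_mem P r w]
    with Q hQ_ball hQ_support h_all hQ
  obtain ⟨m, v, h_cone, hv⟩ := hQ.exists_generators_sub_mem hr
  rw [h_cone]
  refine coneOf_subset_localCone fun i => ?_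
  have hv_mem : v i ∈ localCone Q r := h_cone ▸ mem_coneOf_self v i
  have hv_norm : ‖v i‖ ≤ (supportFun P r + 1 - ⟪r, c⟫) / (ρ / 2) := by
    have h_le := mul_norm_le_of_mem_localCone (half_pos hρ).le hQ_ball hv_mem (hv i).2
    rw [le_div_iff₀' (half_pos hρ)]
    linarith
  exact h_all _ ⟨(hv i).1, hv_norm⟩ hv_mem (hv i).2

end NearbyDelzant

section PlaneFan

open Filter Topology
open scoped RealInnerProductSpace

theorem IsPolytope.notMem_localCone_generator {n m : ℕ}
    {P : ConvexBody (EuclideanSpace ℝ (Fin n))} (hP : IsPolytope P)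
    {v : Fin m → EuclideanSpace ℝ (Fin n)} (hv : LinearIndependent ℝ v)
    {α : EuclideanSpace ℝ (Fin n)} (h_cone : localCone P α = coneOf v) {i j : Fin m} (hij : i ≠ j) :
    α ∉ localCone P (v j) := fun h => by
  have h_eq : localCone P (v j) = coneOf v := h_cone ▸ (localCone_subset_localCone
    (h_cone ▸ mem_coneOf_self v j)).antisymm (localCone_subset_localCone h)
  have h_pos := hP.pos_of_localCone_eq_coneOf hv h_eq (a := Pi.single j 1)
    (by simp [Pi.single_apply]) i
  rw [Pi.single_eq_of_ne hij] at h_pos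
  exact h_pos.false

variable {P Q : ConvexBody (EuclideanSpace ℝ (Fin 2))}

theorem IsPolytope.sub_neg_of_coeff_neg (hP : IsPolytope P)
    {v : Fin 2 → EuclideanSpace ℝ (Fin 2)} (hv : LinearIndependent ℝ v)
    {α : EuclideanSpace ℝ (Fin 2)} (h_cone : localCone P α = coneOf v) (hQ : localCone Q 0 ⊆ {0})
    (h : ∀ i, localCone Q (v i) ⊆ localCone P (v i)) {a b : Fin 2 → ℝ} (ha : α = ∑ i, a i • v i)
    (hb : ∑ i, b i • v i ∈ localCone Q α) {i j : Fin 2} (hij : i ≠ j) (hbi : b i < 0) :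
    a i * b j - b i * a j < 0 := by
  have ha_pos := hP.pos_of_localCone_eq_coneOf hv h_cone ha
  have h_univ : ∀ i j : Fin 2, i ≠ j → (Finset.univ : Finset (Fin 2)) = {i, j} := by decide
  -- The segment from `α` to `β` meets the line through `v j`. It cannot do so on the ray of `v j`,
  -- since then `α`, whose coefficients are positive, would lie in the cone of that ray.
  have h_ray : (-b i) • α + a i • ∑ k, b k • v k = (a i * b j - b i * a j) • v j := by
    rw [ha, h_univ i j hij, Finset.sum_pair hij, Finset.sum_pair hij]
    module
  have hα : α ∈ localCone Q ((a i * b j - b i * a j) • v j) :=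
    h_ray ▸ mem_localCone_add hb (neg_pos.mpr hbi) (ha_pos i).le
  by_contra! hs
  refine hP.notMem_localCone_generator hv h_cone hij ?_
  rcases hs.eq_or_lt with hs | hs
  · rw [← hs, zero_smul] at hα
    rw [Set.mem_singleton_iff.mp (hQ hα)]
    simpa using smul_mem_localCone (self_mem_localCone P (v j)) le_rfl
  · exact h j (localCone_subset_localCone
      (smul_mem_localCone (self_mem_localCone Q (v j)) hs.le) hα)

theorem IsPolytope.localCone_subset_of_pair (hP : IsPolytope P)
    {v : Fin 2 → EuclideanSpace ℝ (Fin 2)} (hv : LinearIndependent ℝ v)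
    {α : EuclideanSpace ℝ (Fin 2)} (h_cone : localCone P α = coneOf v) (hQ : localCone Q 0 ⊆ {0})
    (h : ∀ i, localCone Q (v i) ⊆ localCone P (v i)) : localCone Q α ⊆ localCone P α := by
  intro β hβ
  obtain ⟨a, -, ha⟩ := h_cone ▸ self_mem_localCone P α
  have ha_pos := hP.pos_of_localCone_eq_coneOf hv h_cone ha
  have h_span : Submodule.span ℝ (Set.range v) = ⊤ :=
    hv.span_eq_top_of_card_eq_finrank' (by simp)
  obtain ⟨b, rfl⟩ :=
    (Submodule.mem_span_range_iff_exists_fun ℝ).mp (h_span ▸ Submodule.mem_top (x := β))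
  refine h_cone ▸ ⟨b, fun i => ?_, rfl⟩
  by_contra! hbi
  obtain ⟨j, hji⟩ := exists_ne i
  have hij := hP.sub_neg_of_coeff_neg hv h_cone hQ h ha hβ hji.symm hbi
  have hbj : b j < 0 := by nlinarith [ha_pos i, ha_pos j]
  linarith [hP.sub_neg_of_coeff_neg hv h_cone hQ h ha hβ hji hbj]

theorem IsPolytope.localCone_subset_of_generators (hP : IsPolytope P) {m : ℕ}
    {v : Fin m → EuclideanSpace ℝ (Fin 2)} (hv : LinearIndependent ℝ v)
    {α : EuclideanSpace ℝ (Fin 2)} (h_cone : localCone P α = coneOf v) (hQ : localCone Q 0 ⊆ {0})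
    (h : ∀ i, localCone Q (v i) ⊆ localCone P (v i)) : localCone Q α ⊆ localCone P α := by
  obtain ⟨a, -, ha⟩ := h_cone ▸ self_mem_localCone P α
  have hm : m ≤ 2 := by simpa using hv.fintype_card_le_finrank
  interval_cases m
  · obtain rfl : α = 0 := by simpa using ha
    exact hQ.trans (Set.singleton_subset_iff.mpr (self_mem_localCone P 0))
  · have ha_pos := hP.pos_of_localCone_eq_coneOf hv h_cone ha 0
    rw [Fin.sum_univ_one] at ha
    have hα : α ∈ localCone Q (v 0) :=
      ha ▸ smul_mem_localCone (self_mem_localCone Q (v 0)) ha_pos.le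
    exact ((localCone_subset_localCone hα).trans (h 0)).trans
      (localCone_subset_localCone (h_cone ▸ mem_coneOf_self v 0))
  · exact hP.localCone_subset_of_pair hv h_cone hQ h

theorem IsDelzant.exists_finite_refines (hP : IsDelzant P) :
    ∃ G : Set (EuclideanSpace ℝ (Fin 2)), G.Finite ∧ (∀ v ∈ G, IsPrimitive v) ∧
      ∀ Q : ConvexBody (EuclideanSpace ℝ (Fin 2)), localCone Q 0 ⊆ {0} →
        (∀ v ∈ G, localCone Q v ⊆ localCone P v) → Refines Q P := by
  have h_poly : IsPolytope P := hP.1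
  choose! m v h_prim hv h_cone _ using hP.2.2
  refine ⟨⋃ C ∈ normalFan (P : Set (EuclideanSpace ℝ (Fin 2))), Set.range (v C),
    h_poly.finite_normalFan.biUnion fun C _ => Set.finite_range _, ?_, fun Q hQ hG α => ?_⟩
  · simp only [Set.mem_iUnion, Set.mem_range]
    rintro _ ⟨C, hC, i, rfl⟩
    exact h_prim C hC i
  · have hα : localCone P α ∈ normalFan (P : Set (EuclideanSpace ℝ (Fin 2))) := ⟨α, rfl⟩
    exact h_poly.localCone_subset_of_generators (hv _ hα) (h_cone _ hα) hQ fun i =>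
      hG _ (Set.mem_biUnion hα (Set.mem_range_self i))

theorem IsDelzant.eventually_refines (hP : IsDelzant P) :
    ∀ᶠ Q in 𝓝 P, IsDelzant Q → Refines Q P := by
  obtain ⟨G, hG, h_prim, h⟩ := hP.exists_finite_refines
  filter_upwards [hG.eventually_all.mpr fun v hv =>
    eventually_localCone_subset hP (h_prim v hv).mem_integerLattice] with Q hQ hQ_delzant
  exact h Q (isDelzant_iff.mp hQ_delzant).2.1 fun v hv => hQ v hv hQ_delzant

end PlaneFan

section UnimodularCone

open scoped RealInnerProductSpace

variable {n m : ℕ} {v w : Fin m → EuclideanSpace ℝ (Fin n)}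

theorem exists_intCast_eq_inner {x y : EuclideanSpace ℝ (Fin n)} (hx : x ∈ integerLattice n)
    (hy : y ∈ integerLattice n) : ∃ k : ℤ, ⟪x, y⟫ = k := by
  choose a ha using hx
  choose b hb using hy
  exact ⟨∑ i, a i * b i, by simp [PiLp.inner_apply, ha, hb, mul_comm]⟩

theorem isPrimitive_of_inner_eq_one {x y : EuclideanSpace ℝ (Fin n)} (hx : x ∈ integerLattice n)
    (hy : y ∈ integerLattice n) (h : ⟪x, y⟫ = 1) : IsPrimitive x := by
  choose a ha using hx
  choose b hb using hy
  refine ⟨a, ha, ?_⟩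
  have h_sum : ∑ i, a i * b i = 1 := by
    simpa [PiLp.inner_apply, ha, hb, mul_comm, ← Int.cast_mul, ← Int.cast_sum] using h
  rw [← Finset.normalize_gcd, normalize_eq_one]
  exact isUnit_of_dvd_one (h_sum ▸ Finset.dvd_sum fun i hi =>
    (Finset.gcd_dvd hi).mul_right (b i))

theorem isUnimodularCone_coneOf_of_dual (hv : ∀ i, v i ∈ integerLattice n)
    (hw : ∀ i, w i ∈ integerLattice n) (h : ∀ i j, ⟪w i, v j⟫ = if i = j then 1 else 0) :
    IsUnimodularCone (coneOf v) := by
  have h_coeff : ∀ (c : Fin m → ℝ) (i : Fin m), ⟪w i, ∑ j, c j • v j⟫ = c i := fun c i => by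
    simp [inner_sum, real_inner_smul_right, h]
  refine ⟨m, v, fun i => ?_, ?_, rfl, coneMultiplicity_eq_one_iff.mpr fun x hx hx_int => ?_⟩
  · exact isPrimitive_of_inner_eq_one (hv i) (hw i) (by rw [real_inner_comm, h, if_pos rfl])
  · exact Fintype.linearIndependent_iff.mpr fun c hc i => by
      rw [← h_coeff c i, hc, inner_zero_right]
  · rw [span_coneOf] at hx
    obtain ⟨c, rfl⟩ := (Submodule.mem_span_range_iff_exists_fun ℝ).mp hx
    choose k hk using fun i => exists_intCast_eq_inner (hw i) hx_int
    refine ⟨k, Finset.sum_congr rfl fun i _ => ?_⟩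
    rw [← Int.cast_smul_eq_zsmul ℝ, ← hk, h_coeff]

theorem coneOf_comp {k : ℕ} {f : Fin k → Fin m} (hf : Function.Injective f)
    (v : Fin m → EuclideanSpace ℝ (Fin n)) :
    coneOf (v ∘ f) = {x | ∃ c : Fin m → ℝ, 0 ≤ c ∧ Function.support c ⊆ Set.range f ∧
      x = ∑ i, c i • v i} := by
  have h_sum : ∀ c : Fin m → ℝ, Function.support c ⊆ Set.range f →
      ∑ j, c (f j) • v (f j) = ∑ i, c i • v i := fun c hc =>
    Fintype.sum_of_injective f hf _ _
      (fun i hi => by rw [Function.notMem_support.mp fun h_mem => hi (hc h_mem), zero_smul])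
      fun _ => rfl
  ext x
  constructor
  · rintro ⟨c, hc, rfl⟩
    have h_support : Function.support (Function.extend f c 0) ⊆ Set.range f :=
      Function.support_extend_zero_subset.trans (Set.image_subset_range _ _)
    refine ⟨Function.extend f c 0, Function.extend_nonneg hc le_rfl, h_support, ?_⟩
    rw [← h_sum _ h_support]
    simp only [hf.extend_apply, Function.comp_apply]
  · rintro ⟨c, hc, h_support, rfl⟩
    exact ⟨c ∘ f, fun j => hc _, (h_sum c h_support).symm⟩

theorem isUnimodularCone_face_of_dual (hv : ∀ i, v i ∈ integerLattice n)
    (hw : ∀ i, w i ∈ integerLattice n) (h : ∀ i j, ⟪w i, v j⟫ = if i = j then 1 else 0)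
    (s : Set (Fin m)) :
    IsUnimodularCone {x | ∃ c : Fin m → ℝ, 0 ≤ c ∧ Function.support c ⊆ s ∧
      x = ∑ i, c i • v i} := by
  classical
  let f : Fin (Fintype.card s) → Fin m := Subtype.val ∘ (Fintype.equivFin s).symm
  have hf : Function.Injective f := Subtype.val_injective.comp (Equiv.injective _)
  have h_range : Set.range f = s := by rw [(Equiv.surjective _).range_comp, Subtype.range_val]
  rw [← h_range, ← coneOf_comp hf]
  exact isUnimodularCone_coneOf_of_dual (w := w ∘ f) (fun j => hv _) (fun j => hw _)
    fun i j => by simp [h, hf.eq_iff]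

end UnimodularCone

section FareyPair

/-- The determinant of two vectors of `ℤ²`. -/
def intDet (a b : ℤ × ℤ) : ℤ := a.1 * b.2 - a.2 * b.1

/-- The vectors of `ℤ²` whose coordinates have absolute value at most `N`. -/
noncomputable def box (N : ℕ) : Finset (ℤ × ℤ) := Finset.Icc (-N) N

variable {N : ℕ} {a b e : ℤ × ℤ}

theorem mem_box : e ∈ box N ↔ |e.1| ≤ N ∧ |e.2| ≤ N := by
  simp [box, Prod.le_def, abs_le, and_and_and_comm]

theorem neg_mem_box : -e ∈ box N ↔ e ∈ box N := by
  simp [mem_box]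

theorem intDet_smul_eq (a b e : ℤ × ℤ) :
    intDet a b • e = intDet e b • a + intDet a e • b := by
  ext <;> simp only [intDet, Prod.fst_add, Prod.snd_add, Prod.smul_fst, Prod.smul_snd,
    smul_eq_mul] <;> ring

theorem abs_add_le_abs_smul_add_smul {a b s t : ℤ} (h : 0 ≤ a * b) (hs : 0 < s) (ht : 0 < t) :
    |a + b| ≤ |s * a + t * b| := by
  rcases mul_nonneg_iff.mp h with ⟨ha, hb⟩ | ⟨ha, hb⟩
  · rw [abs_of_nonneg (by positivity), abs_of_nonneg (by positivity)]
    nlinarith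
  · rw [abs_of_nonpos (by linarith), abs_of_nonpos (by nlinarith)]
    nlinarith

/-- An oriented basis of `ℤ²` consisting of two vectors of the box of size `N` which lie in a
common quadrant; the last condition is the inequality `0 ≤ a * b` in the product order. -/
structure IsFareyPair (N : ℕ) (a b : ℤ × ℤ) : Prop where
  det_eq_one : intDet a b = 1
  left_mem : a ∈ box N
  right_mem : b ∈ box N
  same_quadrant : 0 ≤ a * b

namespace IsFareyPair

theorem add_left (h : IsFareyPair N a b) (hab : a + b ∈ box N) : IsFareyPair N (a + b) b where
  det_eq_one := by
    rw [← h.det_eq_one, intDet, intDet, Prod.fst_add, Prod.snd_add]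
    ring
  left_mem := hab
  right_mem := h.right_mem
  same_quadrant := by
    rw [add_mul]
    exact add_nonneg h.same_quadrant ⟨mul_self_nonneg b.1, mul_self_nonneg b.2⟩

theorem add_right (h : IsFareyPair N a b) (hab : a + b ∈ box N) : IsFareyPair N a (a + b) where
  det_eq_one := by
    rw [← h.det_eq_one, intDet, intDet, Prod.fst_add, Prod.snd_add]
    ring
  left_mem := h.left_mem
  right_mem := hab
  same_quadrant := by
    rw [mul_add]
    exact add_nonneg ⟨mul_self_nonneg a.1, mul_self_nonneg a.2⟩ h.same_quadrant

theorem left_mul_self_pos (h : IsFareyPair N a b) : 0 < a.1 * a.1 + a.2 * a.2 := by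
  have h_det := h.det_eq_one
  refine (add_nonneg (mul_self_nonneg _) (mul_self_nonneg _)).lt_of_ne' fun h0 => ?_
  rw [mul_self_add_mul_self_eq_zero] at h0
  simp [intDet, h0] at h_det

theorem right_mul_self_pos (h : IsFareyPair N a b) : 0 < b.1 * b.1 + b.2 * b.2 := by
  have h_det := h.det_eq_one
  refine (add_nonneg (mul_self_nonneg _) (mul_self_nonneg _)).lt_of_ne' fun h0 => ?_
  rw [mul_self_add_mul_self_eq_zero] at h0
  simp [intDet, h0] at h_det

theorem smul_add_smul_notMem_box (h : IsFareyPair N a b) (hab : a + b ∉ box N) {s t : ℤ}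
    (hs : 0 < s) (ht : 0 < t) : s • a + t • b ∉ box N := fun h_mem => by
  rw [mem_box] at h_mem hab
  exact hab ⟨(abs_add_le_abs_smul_add_smul h.same_quadrant.1 hs ht).trans h_mem.1,
    (abs_add_le_abs_smul_add_smul h.same_quadrant.2 hs ht).trans h_mem.2⟩

theorem intDet_mul_intDet_nonpos (h : IsFareyPair N a b) (hab : a + b ∉ box N) (he : e ∈ box N) :
    intDet e b * intDet a e ≤ 0 := by
  have h_eq := intDet_smul_eq a b e
  rw [h.det_eq_one, one_smul] at h_eq
  by_contra! h_pos
  rcases mul_pos_iff.mp h_pos with ⟨hs, ht⟩ | ⟨hs, ht⟩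
  · exact h.smul_add_smul_notMem_box hab hs ht (h_eq ▸ he)
  · refine h.smul_add_smul_notMem_box hab (neg_pos.mpr hs) (neg_pos.mpr ht) ?_
    rw [neg_smul, neg_smul, ← neg_add, ← h_eq]
    exact neg_mem_box.mpr he

end IsFareyPair

end FareyPair

section FareyZonotope

open Filter Topology Pointwise
open scoped RealInnerProductSpace

/-- The vector of the plane with given integer coordinates. -/
noncomputable def intVec (z : ℤ × ℤ) : EuclideanSpace ℝ (Fin 2) := !₂[(z.1 : ℝ), (z.2 : ℝ)]

/-- The determinant of two vectors of the plane. -/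
noncomputable def planeDet (x y : EuclideanSpace ℝ (Fin 2)) : ℝ := x 0 * y 1 - x 1 * y 0

/-- The rotation of the plane by a quarter turn, which turns `planeDet` into the inner product. -/
noncomputable def quarterTurn (x : EuclideanSpace ℝ (Fin 2)) : EuclideanSpace ℝ (Fin 2) :=
  !₂[-x 1, x 0]

@[simp] theorem intVec_apply_zero (z : ℤ × ℤ) : intVec z 0 = z.1 := rfl

@[simp] theorem intVec_apply_one (z : ℤ × ℤ) : intVec z 1 = z.2 := rfl

theorem intVec_neg (z : ℤ × ℤ) : intVec (-z) = -intVec z := by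
  ext i
  fin_cases i <;> simp

theorem intVec_add (z z' : ℤ × ℤ) : intVec (z + z') = intVec z + intVec z' := by
  ext i
  fin_cases i <;> simp

theorem intVec_mem_integerLattice (z : ℤ × ℤ) : intVec z ∈ integerLattice 2 :=
  Fin.forall_fin_two.mpr ⟨⟨z.1, rfl⟩, ⟨z.2, rfl⟩⟩

theorem exists_intVec_eq {x : EuclideanSpace ℝ (Fin 2)} (hx : x ∈ integerLattice 2) :
    ∃ z, intVec z = x := by
  choose z hz using hx
  refine ⟨(z 0, z 1), ?_⟩
  ext i
  fin_cases i <;> simp [hz]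

theorem inner_quarterTurn (x y : EuclideanSpace ℝ (Fin 2)) :
    ⟪x, quarterTurn y⟫ = planeDet y x := by
  simp only [quarterTurn, planeDet, PiLp.inner_apply, Fin.sum_univ_two, RCLike.inner_apply,
    conj_trivial, Matrix.cons_val_zero, Matrix.cons_val_one]
  ring

theorem planeDet_intVec (a b : ℤ × ℤ) : planeDet (intVec a) (intVec b) = intDet a b := by
  simp [planeDet, intDet]

theorem quarterTurn_intVec (z : ℤ × ℤ) : quarterTurn (intVec z) = intVec (-z.2, z.1) := by
  ext i
  fin_cases i <;> simp [quarterTurn]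

theorem planeDet_smul_eq (x y z : EuclideanSpace ℝ (Fin 2)) :
    planeDet x y • z = planeDet z y • x + planeDet x z • y := by
  ext i
  fin_cases i <;> simp only [planeDet, PiLp.add_apply, PiLp.smul_apply, smul_eq_mul, Fin.zero_eta,
    Fin.mk_one] <;> ring

theorem planeDet_self (x : EuclideanSpace ℝ (Fin 2)) : planeDet x x = 0 := by
  rw [planeDet, mul_comm, sub_self]

theorem planeDet_swap (x y : EuclideanSpace ℝ (Fin 2)) : planeDet y x = -planeDet x y := by
  simp only [planeDet]
  ring

theorem planeDet_neg_left (x y : EuclideanSpace ℝ (Fin 2)) :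
    planeDet (-x) y = -planeDet x y := by
  simp only [planeDet, PiLp.neg_apply]
  ring

theorem planeDet_smul_add_smul (x y z : EuclideanSpace ℝ (Fin 2)) (c d : ℝ) :
    planeDet x (c • y + d • z) = c * planeDet x y + d * planeDet x z := by
  simp only [planeDet, PiLp.add_apply, PiLp.smul_apply, smul_eq_mul]
  ring

namespace IsFareyPair

variable {N : ℕ} {a b : ℤ × ℤ}

theorem planeDet_eq_one (h : IsFareyPair N a b) : planeDet (intVec a) (intVec b) = 1 := by
  rw [planeDet_intVec, h.det_eq_one, Int.cast_one]

theorem eq_smul_add_smul (h : IsFareyPair N a b) (x : EuclideanSpace ℝ (Fin 2)) :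
    x = planeDet x (intVec b) • intVec a + planeDet (intVec a) x • intVec b := by
  rw [← planeDet_smul_eq, h.planeDet_eq_one, one_smul]

theorem isUnimodularCone_face (h : IsFareyPair N a b) (s : Set (Fin 2)) :
    IsUnimodularCone {x | ∃ c : Fin 2 → ℝ, 0 ≤ c ∧ Function.support c ⊆ s ∧
      x = ∑ i, c i • ![intVec a, intVec b] i} := by
  refine isUnimodularCone_face_of_dual
    (w := ![quarterTurn (intVec (-b)), quarterTurn (intVec a)]) ?_ ?_ ?_ s
  · simp [Fin.forall_fin_two, intVec_mem_integerLattice]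
  · simp [Fin.forall_fin_two, quarterTurn_intVec, intVec_mem_integerLattice]
  · have h_det := h.planeDet_eq_one
    simp [Fin.forall_fin_two, real_inner_comm, inner_quarterTurn, planeDet_self, intVec_neg,
      planeDet_neg_left, planeDet_swap (intVec a) (intVec b), h_det]

end IsFareyPair

theorem isFareyPair_of_coordinates {N : ℕ} (hN : 1 ≤ N) {a b : ℤ × ℤ} (h_det : intDet a b = 1)
    (ha : |a.1| ≤ 1 ∧ |a.2| ≤ 1) (hb : |b.1| ≤ 1 ∧ |b.2| ≤ 1) (hab : a * b = 0) :
    IsFareyPair N a b :=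
  have hN' : (1 : ℤ) ≤ N := by exact_mod_cast hN
  ⟨h_det, mem_box.mpr ⟨ha.1.trans hN', ha.2.trans hN'⟩,
    mem_box.mpr ⟨hb.1.trans hN', hb.2.trans hN'⟩, hab.ge⟩

theorem exists_isFareyPair_smul_add_smul {N : ℕ} (hN : 1 ≤ N) (α : EuclideanSpace ℝ (Fin 2)) :
    ∃ a b, IsFareyPair N a b ∧ ∃ x y : ℝ, 0 ≤ x ∧ 0 ≤ y ∧ α = x • intVec a + y • intVec b := by
  have h_basis : ∀ {a b : ℤ × ℤ}, IsFareyPair N a b →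
      0 ≤ planeDet α (intVec b) → 0 ≤ planeDet (intVec a) α →
        ∃ a b, IsFareyPair N a b ∧ ∃ x y : ℝ, 0 ≤ x ∧ 0 ≤ y ∧
          α = x • intVec a + y • intVec b := fun h hx hy =>
    ⟨_, _, h, _, _, hx, hy, h.eq_smul_add_smul α⟩
  rcases le_total 0 (α 0) with h0 | h0 <;> rcases le_total 0 (α 1) with h1 | h1
  · exact h_basis (a := (1, 0)) (b := (0, 1))
      (isFareyPair_of_coordinates hN rfl (by simp) (by simp) rfl)
      (by simpa [planeDet]) (by simpa [planeDet])
  · exact h_basis (a := (0, -1)) (b := (1, 0))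
      (isFareyPair_of_coordinates hN rfl (by simp) (by simp) rfl)
      (by simpa [planeDet]) (by simpa [planeDet])
  · exact h_basis (a := (0, 1)) (b := (-1, 0))
      (isFareyPair_of_coordinates hN rfl (by simp) (by simp) rfl)
      (by simpa [planeDet]) (by simpa [planeDet])
  · exact h_basis (a := (-1, 0)) (b := (0, -1))
      (isFareyPair_of_coordinates hN rfl (by simp) (by simp) rfl)
      (by simpa [planeDet]) (by simpa [planeDet])

theorem exists_isFareyPair {N : ℕ} (hN : 1 ≤ N) (α : EuclideanSpace ℝ (Fin 2)) :
    ∃ a b, IsFareyPair N a b ∧ ∃ x y : ℝ, 0 ≤ x ∧ 0 ≤ y ∧ α = x • intVec a + y • intVec b ∧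
      (0 < x → 0 < y → a + b ∉ box N) := by
  let S : Set ((ℤ × ℤ) × (ℤ × ℤ)) := {p | IsFareyPair N p.1 p.2 ∧
    ∃ x y : ℝ, 0 ≤ x ∧ 0 ≤ y ∧ α = x • intVec p.1 + y • intVec p.2}
  have hS : S.Finite := (box N ×ˢ box N).finite_toSet.subset fun p hp =>
    Finset.mem_coe.mpr (Finset.mem_product.mpr ⟨hp.1.left_mem, hp.1.right_mem⟩)
  have hS_nonempty : S.Nonempty :=
    let ⟨a, b, h⟩ := exists_isFareyPair_smul_add_smul hN α
    ⟨(a, b), h⟩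
  -- The pair of `S` with the largest scalar product is the narrowest one around `α`.
  obtain ⟨⟨a, b⟩, ⟨h, x, y, hx, hy, hα⟩, h_max⟩ := Set.exists_max_image S
    (fun p => p.1.1 * p.2.1 + p.1.2 * p.2.2) hS hS_nonempty
  refine ⟨a, b, h, x, y, hx, hy, hα, fun _ _ hab => ?_⟩
  rcases le_total y x with hxy | hxy
  · have h_le := h_max (a, a + b) ⟨h.add_right hab, x - y, y, sub_nonneg.mpr hxy, hy, by
      rw [hα, intVec_add]; module⟩
    have h_pos := h.left_mul_self_pos
    simp only [Prod.fst_add, Prod.snd_add] at h_le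
    linarith
  · have h_le := h_max (a + b, b) ⟨h.add_left hab, x, y - x, hx, sub_nonneg.mpr hxy, by
      rw [hα, intVec_add]; module⟩
    have h_pos := h.right_mul_self_pos
    simp only [Prod.fst_add, Prod.snd_add] at h_le
    linarith

/-- The segment from `0` to `e`. -/
noncomputable def segmentBody {n : ℕ} (e : EuclideanSpace ℝ (Fin n)) :
    ConvexBody (EuclideanSpace ℝ (Fin n)) where
  carrier := segment ℝ 0 e
  convex' := convex_segment 0 e
  isCompact' := by
    rw [← convexHull_pair]
    exact (Set.toFinite _).isCompact_convexHull (𝕜 := ℝ)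
  nonempty' := ⟨0, left_mem_segment ℝ 0 e⟩

theorem coe_segmentBody {n : ℕ} (e : EuclideanSpace ℝ (Fin n)) :
    (segmentBody e : Set (EuclideanSpace ℝ (Fin n))) =
      convexHull ℝ (({0, e} : Finset (EuclideanSpace ℝ (Fin n))) : Set _) := by
  rw [Finset.coe_pair, convexHull_pair]
  rfl

theorem supportFun_segmentBody {n : ℕ} (e u : EuclideanSpace ℝ (Fin n)) :
    supportFun (segmentBody e) u = max 0 ⟪u, e⟫ := by
  refine le_antisymm ?_ (max_le ?_ (inner_le_supportFun (right_mem_segment ℝ 0 e) u))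
  · obtain ⟨_, ⟨s, t, hs, ht, hst, rfl⟩, hu⟩ := exists_inner_eq_supportFun (segmentBody e) u
    rw [← hu, smul_zero, zero_add, real_inner_smul_right]
    nlinarith [le_max_left 0 ⟪u, e⟫, le_max_right 0 ⟪u, e⟫]
  · simpa using inner_le_supportFun (P := segmentBody e) (left_mem_segment ℝ 0 e) u

theorem mem_localCone_segmentBody {n : ℕ} {e α β : EuclideanSpace ℝ (Fin n)} :
    β ∈ localCone (segmentBody e) α ↔
      (0 ≤ ⟪α, e⟫ → 0 ≤ ⟪β, e⟫) ∧ (⟪α, e⟫ ≤ 0 → ⟪β, e⟫ ≤ 0) := by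
  rw [mem_localCone_iff_of_eq_convexHull (coe_segmentBody e)]
  simp [supportFun_segmentBody, and_comm]

/-- The zonotope whose normal fan is cut out by the lines through the vectors of the box of size
`N`; its rays are the Farey directions of order `N`. -/
noncomputable def fareyZonotope (N : ℕ) : ConvexBody (EuclideanSpace ℝ (Fin 2)) :=
  ∑ e ∈ box N, segmentBody (quarterTurn (intVec e))

variable {N : ℕ} {α β : EuclideanSpace ℝ (Fin 2)}

theorem mem_localCone_fareyZonotope : β ∈ localCone (fareyZonotope N) α ↔
    ∀ e ∈ box N, 0 ≤ planeDet (intVec e) α → 0 ≤ planeDet (intVec e) β := by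
  simp only [fareyZonotope, localCone_sum, Set.mem_iInter, mem_localCone_segmentBody,
    inner_quarterTurn]
  refine ⟨fun h e he => (h e he).1, fun h e he => ⟨h e he, fun h_neg => ?_⟩⟩
  simpa [intVec_neg, planeDet_neg_left, h_neg] using h (-e) (neg_mem_box.mpr he)

namespace IsFareyPair

variable {a b e : ℤ × ℤ} {x y c d : ℝ}

theorem planeDet_mul_planeDet_nonneg (h : IsFareyPair N a b) (hab : a + b ∉ box N)
    (he : e ∈ box N) :
    0 ≤ planeDet (intVec e) (intVec a) * planeDet (intVec e) (intVec b) := by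
  have h_nonpos : (intDet e b : ℝ) * intDet a e ≤ 0 := by
    exact_mod_cast h.intDet_mul_intDet_nonpos hab he
  rw [planeDet_swap (intVec a), planeDet_intVec, planeDet_intVec]
  linarith

theorem nonneg_of_smul_add_smul_mem_localCone (h : IsFareyPair N a b) (hx : 0 ≤ x) (hy : 0 ≤ y)
    (h_mem : c • intVec a + d • intVec b ∈
      localCone (fareyZonotope N) (x • intVec a + y • intVec b)) :
    0 ≤ c ∧ 0 ≤ d ∧ (x = 0 → c = 0) ∧ (y = 0 → d = 0) := by
  have h_ba : planeDet (intVec b) (intVec a) = -1 := by rw [planeDet_swap, h.planeDet_eq_one]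
  simp only [mem_localCone_fareyZonotope, planeDet_smul_add_smul] at h_mem
  have h_box := fun e he => And.intro (h_mem e he) (h_mem (-e) (neg_mem_box.mpr he))
  simp only [intVec_neg, planeDet_neg_left] at h_box
  obtain ⟨ha, ha'⟩ := h_box a h.left_mem
  obtain ⟨hb, hb'⟩ := h_box b h.right_mem
  simp only [planeDet_self, h.planeDet_eq_one, h_ba] at ha ha' hb hb'
  have hc : 0 ≤ c := by linarith [hb' (by linarith)]
  have hd : 0 ≤ d := by linarith [ha (by linarith)]
  exact ⟨hc, hd, fun hx0 => by linarith [hb (by linarith)], fun hy0 => by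
    linarith [ha' (by linarith)]⟩

theorem smul_add_smul_mem_localCone (h : IsFareyPair N a b) (hx : 0 ≤ x) (hy : 0 ≤ y)
    (hxy : 0 < x → 0 < y → a + b ∉ box N) (hc : 0 ≤ c) (hd : 0 ≤ d) (hxc : x = 0 → c = 0)
    (hyd : y = 0 → d = 0) : c • intVec a + d • intVec b ∈
      localCone (fareyZonotope N) (x • intVec a + y • intVec b) := by
  simp only [mem_localCone_fareyZonotope, planeDet_smul_add_smul]
  intro e he hα
  rcases hx.eq_or_lt with rfl | hx <;> rcases hy.eq_or_lt with rfl | hy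
  · simp [hxc rfl, hyd rfl]
  · rw [zero_mul, zero_add] at hα
    rw [hxc rfl, zero_mul, zero_add]
    exact mul_nonneg hd (nonneg_of_mul_nonneg_right hα hy)
  · rw [zero_mul, add_zero] at hα
    rw [hyd rfl, zero_mul, add_zero]
    exact mul_nonneg hc (nonneg_of_mul_nonneg_right hα hx)
  · have h_sign := h.planeDet_mul_planeDet_nonneg (hxy hx hy) he
    rcases mul_nonneg_iff.mp h_sign with ⟨ha, hb⟩ | ⟨ha, hb⟩
    · positivity
    · have ha0 : planeDet (intVec e) (intVec a) = 0 := by nlinarith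
      have hb0 : planeDet (intVec e) (intVec b) = 0 := by nlinarith
      simp [ha0, hb0]

end IsFareyPair

theorem isUnimodularCone_localCone_fareyZonotope (hN : 1 ≤ N) (α : EuclideanSpace ℝ (Fin 2)) :
    IsUnimodularCone (localCone (fareyZonotope N) α) := by
  obtain ⟨a, b, h, x, y, hx, hy, rfl, hxy⟩ := exists_isFareyPair hN α
  convert h.isUnimodularCone_face (Function.support ![x, y]) using 1
  ext β
  simp only [Set.mem_ofPred_eq, Pi.le_def, Function.support_subset_iff', Function.notMem_support,
    Fin.forall_fin_two, Fin.sum_univ_two, Pi.zero_apply, Matrix.cons_val_zero, Matrix.cons_val_one]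
  constructor
  · intro hβ
    rw [h.eq_smul_add_smul β] at hβ
    obtain ⟨hc, hd, hxc, hyd⟩ := h.nonneg_of_smul_add_smul_mem_localCone hx hy hβ
    exact ⟨![_, _], ⟨hc, hd⟩, ⟨hxc, hyd⟩, h.eq_smul_add_smul β⟩
  · rintro ⟨c, ⟨hc, hd⟩, ⟨hxc, hyd⟩, rfl⟩
    exact h.smul_add_smul_mem_localCone hx hy hxy hc hd hxc hyd

theorem isDelzant_fareyZonotope (hN : 1 ≤ N) : IsDelzant (fareyZonotope N) := by
  refine isDelzant_iff.mpr ⟨.sum _ fun _ _ => ⟨_, coe_segmentBody _⟩, ?_,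
    isUnimodularCone_localCone_fareyZonotope hN⟩
  obtain ⟨a, b, h, -⟩ := exists_isFareyPair_smul_add_smul hN 0
  intro β hβ
  rw [h.eq_smul_add_smul β] at hβ
  obtain ⟨-, -, hc, hd⟩ := h.nonneg_of_smul_add_smul_mem_localCone (x := 0) (y := 0) le_rfl le_rfl
    (by simpa using hβ)
  rw [Set.mem_singleton_iff, h.eq_smul_add_smul β, hc rfl, hd rfl, zero_smul, zero_smul, add_zero]

theorem exists_smul_eq_of_mem_localCone_fareyZonotope {z : ℤ × ℤ} (hz : z ∈ box N)
    (hz0 : intVec z ≠ 0) (hβ : β ∈ localCone (fareyZonotope N) (intVec z)) :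
    ∃ c : ℝ, 0 ≤ c ∧ β = c • intVec z := by
  rw [mem_localCone_fareyZonotope] at hβ
  have h_line : planeDet (intVec z) β = 0 := by
    refine le_antisymm ?_ (hβ z hz (planeDet_self _).ge)
    have h_neg := hβ (-z) (neg_mem_box.mpr hz)
    rw [intVec_neg, planeDet_neg_left, planeDet_neg_left, planeDet_self, neg_zero] at h_neg
    exact neg_nonneg.mp (h_neg le_rfl)
  let e : ℤ × ℤ := (z.2, -z.1)
  have he : e ∈ box N := by simpa [e, mem_box, and_comm] using hz
  have h_pos : 0 < planeDet (intVec e) (intVec z) := by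
    have h_norm : planeDet (intVec e) (intVec z) = ‖intVec z‖ ^ 2 := by
      simp only [e, planeDet, EuclideanSpace.real_norm_sq_eq, Fin.sum_univ_two, intVec_apply_zero,
        intVec_apply_one, Int.cast_neg]
      ring
    rw [h_norm]
    exact pow_pos (norm_pos_iff.mpr hz0) 2
  refine ⟨(planeDet (intVec e) (intVec z))⁻¹ * planeDet (intVec e) β,
    mul_nonneg (inv_nonneg.mpr h_pos.le) (hβ e he h_pos.le), ?_⟩
  have h_cramer := planeDet_smul_eq (intVec e) (intVec z) β
  rw [planeDet_swap (intVec z) β, h_line, neg_zero, zero_smul, zero_add] at h_cramer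
  rw [mul_smul, ← h_cramer, inv_smul_smul₀ h_pos.ne']

theorem eventually_mem_box (z : ℤ × ℤ) : ∀ᶠ N in atTop, z ∈ box N := by
  filter_upwards [eventually_ge_atTop (z.1.natAbs + z.2.natAbs)] with N hN
  rw [mem_box, Int.abs_eq_natAbs, Int.abs_eq_natAbs]
  omega

theorem IsDelzant.eventually_refines_fareyZonotope {P : ConvexBody (EuclideanSpace ℝ (Fin 2))}
    (hP : IsDelzant P) : ∀ᶠ N in atTop, Refines (fareyZonotope N) P := by
  obtain ⟨G, hG, h_prim, h⟩ := hP.exists_finite_refines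
  have h_box : ∀ v ∈ G, ∀ᶠ N in atTop, ∃ z ∈ box N, intVec z = v := fun v hv => by
    obtain ⟨z, rfl⟩ := exists_intVec_eq (h_prim v hv).mem_integerLattice
    exact (eventually_mem_box z).mono fun N hz => ⟨z, hz, rfl⟩
  filter_upwards [hG.eventually_all.mpr h_box, eventually_ge_atTop 1] with N hN hN1
  refine h _ (isDelzant_iff.mp (isDelzant_fareyZonotope hN1)).2.1 fun v hv β hβ => ?_
  obtain ⟨z, hz, rfl⟩ := hN v hv
  obtain ⟨c, hc, rfl⟩ :=
    exists_smul_eq_of_mem_localCone_fareyZonotope hz (h_prim _ hv).ne_zero hβ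
  exact smul_mem_localCone (self_mem_localCone P _) hc

end FareyZonotope

section SimplyConnected

open Filter Topology unitInterval

theorem hausdorffTopology_eq_induced (n : ℕ) :
    hausdorffTopology n = TopologicalSpace.induced
      (Subtype.val : {P : ConvexBody (EuclideanSpace ℝ (Fin n)) // IsDelzant P} → _)
      inferInstance := by
  have h_metric : hausdorffMetric n = PseudoMetricSpace.induced
      (Subtype.val : {P : ConvexBody (EuclideanSpace ℝ (Fin n)) // IsDelzant P} → _)
      inferInstance := by
    refine PseudoMetricSpace.ext ?_
    ext P Q
    exact ConvexBody.hausdorffDist_coe P.1 Q.1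
  rw [hausdorffTopology, h_metric]
  rfl

/-- Minkowski interpolation from `P` to `Q` inside the space of Delzant polytopes, which is
available as soon as the normal fan of `P` refines that of `Q`. -/
noncomputable def minkowskiPathSystem (n : ℕ) :
    PathSystem {P : ConvexBody (EuclideanSpace ℝ (Fin n)) // IsDelzant P} where
  Rel P Q := Refines P.1 Q.1
  path {P Q} h :=
    { toFun t := ⟨minkowskiComb P.1 Q.1 t, P.2.minkowskiComb Q.2 h t.2⟩
      continuous_toFun := Continuous.subtype_mk
        (continuous_minkowskiComb continuous_const continuous_const continuous_subtype_val) _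
      source' := Subtype.ext (minkowskiComb_zero P.1 Q.1)
      target' := Subtype.ext (minkowskiComb_one P.1 Q.1) }
  continuous_path _ hf hg := Continuous.subtype_mk (continuous_minkowskiComb (by fun_prop)
    (by fun_prop) (by fun_prop)) _
  rel_path _ hP hQ t := hP.minkowskiComb hQ t.2

theorem simplyConnectedWith_hausdorffTopology :
    SimplyConnectedWith (hausdorffTopology 2) := by
  rw [SimplyConnectedWith, hausdorffTopology_eq_induced]
  let Z (N : ℕ) : {P : ConvexBody (EuclideanSpace ℝ (Fin 2)) // IsDelzant P} :=
    ⟨fareyZonotope (N + 1), isDelzant_fareyZonotope N.succ_pos⟩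
  have : Nonempty {P : ConvexBody (EuclideanSpace ℝ (Fin 2)) // IsDelzant P} := ⟨Z 0⟩
  refine (minkowskiPathSystem 2).simplyConnectedSpace (Z := Z) (l := atTop) (fun Q => ?_)
    fun P => (tendsto_add_atTop_nat 1).eventually P.2.eventually_refines_fareyZonotope
  filter_upwards [continuousAt_subtype_val.eventually Q.2.eventually_refines] with P hP
  exact hP P.2

end SimplyConnected

end DelzantModuli

/-- The space `𝒟(2)` of Delzant polygons is simply connected, both in the topology induced by the
Hausdorff distance and in the one induced by the symmetric difference distance. -/
theorem mainTheorem9 :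
    DelzantModuli.SimplyConnectedWith (DelzantModuli.hausdorffTopology 2) ∧
      DelzantModuli.SimplyConnectedWith (DelzantModuli.symmDiffTopology 2) := by
  have h := DelzantModuli.simplyConnectedWith_hausdorffTopology
  exact ⟨h, DelzantModuli.hausdorffTopology_eq_symmDiffTopology 2 ▸ h⟩
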